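/- Let $F$ be a field with $\operatorname{char}(F)\neq 2,7$ in which $t^2+t+2$ splits, say $t^2+t+2=(t-c)(t-\bar c)$ with $c,\bar c\in F$, and let $R=F[x,y,z]$ with its standard grading. The Klein configuration in $\mathbb{P}^2_F$ is the set of points obtained by arbitrary permutations of the coordinates from $$(1:0:0),\ (1:\pm1:0),\ (1:\pm1:\pm\bar c),\ (c:\pm1:0),\ (1:\pm1:\pm1),\ (\bar c^2:\pm1:\pm1),$$ with independent signs. Its defining ideal $I\subset R$ is the ideal generated by all forms vanishing at these points. Then: 1. The configuration consists of exactly $49$ points, and $I$ is minimally generated by the three forms of degree $8$ $$\begin{aligned} f&=xy(x^2-y^2)\bigl(4x^4+4y^4+(3c+9)x^2y^2+(5c-1)x^2z^2+(5c-1)y^2z^2+(15c+25)z^4\bigr),\\ g&=yz(y^2-z^2)\bigl((15c+25)x^4+4y^4+(5c-1)x^2y^2+(5c-1)x^2z^2+(3c+9)y^2z^2+4z^4\bigr),\\ h&=zx(z^2-x^2)\bigl(4x^4+(15c+25)y^4+(5c-1)x^2y^2+(3c+9)x^2z^2+(5c-1)y^2z^2+4z^4\bigr). \end{aligned}$$ That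 is, $f,g,h$ generate $I$, no proper subset of them does, and no generating set of $I$ has fewer than three elements. 2. Put $$\begin{aligned} P_1&=z\bigl((15c+21)x^2+(15c+21)y^2+(2c-10)z^2\bigr),\\ P_2&=x\bigl((2c-10)x^2+(15c+21)y^2+(15c+21)z^2\bigr),\\ P_3&=y\bigl((15c+21)x^2+(2c-10)y^2+(15c+21)z^2\bigr). \end{aligned}$$ Then $P_1,P_2,P_3$ is a regular sequence in $R$, and there are $Q_1,Q_2,Q_3\in R$ such that $$0\to R(-11)\oplus R(-13)\xrightarrow{\begin{pmatrix}P_1&Q_1\\P_2&Q_2\\P_3&Q_3\end{pmatrix}}R(-8)^3\xrightarrow{(f\ g\ h)}R\to R/I\to 0$$ is a minimal graded free resolution of $R/I$. In particular $(P_1,P_2,P_3)$ is a minimal syzygy of $(f,g,h)$. -/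

import Mathlib

namespace KleinConfig

open MvPolynomial

/-! ### Graded free modules and resolutions over `R = F[x, y, z]` -/

section Graded

variable {F : Type*} [Field F]

/-- The defining ideal of a set `S` of points of the projective plane: the ideal of `F[x, y, z]`
generated by all forms vanishing on `S`.  (Vanishing of a form at a point does not depend on
the representative.) -/
noncomputable def definingIdeal (S : Set (Projectivization F (Fin 3 → F))) : Ideal (MvPolynomial (Fin 3) F) :=
  Ideal.span {p | (∃ d : ℕ, p.IsHomogeneous d) ∧ ∀ P ∈ S, eval P.rep p = 0}

/-- The homogeneous maximal ideal `(x, y, z)`. -/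
noncomputable def irrelevantIdeal (F : Type*) [Field F] : Ideal (MvPolynomial (Fin 3) F) :=
  Ideal.span (Set.range X)

/-- The elements of degree `d` of the graded free module `⨁ i, R(-a i)`: vectors whose `i`-th entry
is a form of degree `d - a i` (so it is `0` when `d < a i`). -/
def gradedPiece {n : ℕ} (a : Fin n → ℕ) (d : ℕ) : Set (Fin n → MvPolynomial (Fin 3) F) :=
  {v | ∀ i, (a i ≤ d ∧ (v i).IsHomogeneous (d - a i)) ∨ (d < a i ∧ v i = 0)}

/-- `0 → ⨁ j, R(-b j) --φ--> ⨁ i, R(-a i) --ψ--> R` is a minimal graded free resolution of `R ⧸ I`: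
the maps preserve degrees, the complex is exact, the cokernel of `ψ` is `R ⧸ I`, and the images of
the maps lie in the maximal ideal `(x, y, z)` times the target. -/
structure IsMinimalGradedFreeResolution {m n : ℕ} (I : Ideal (MvPolynomial (Fin 3) F))
    (a : Fin m → ℕ) (b : Fin n → ℕ)
    (φ : (Fin n → MvPolynomial (Fin 3) F) →ₗ[MvPolynomial (Fin 3) F]
      (Fin m → MvPolynomial (Fin 3) F))
    (ψ : (Fin m → MvPolynomial (Fin 3) F) →ₗ[MvPolynomial (Fin 3) F] MvPolynomial (Fin 3) F) :
    Prop where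
  graded_left : ∀ d, ∀ v ∈ gradedPiece b d, φ v ∈ gradedPiece a d
  graded_right : ∀ d, ∀ v ∈ gradedPiece a d, (ψ v).IsHomogeneous d
  injective : Function.Injective φ
  exact : Function.Exact φ ψ
  range_eq : LinearMap.range ψ = I
  minimal_left : ∀ v i, φ v i ∈ irrelevantIdeal F
  minimal_right : ∀ v, ψ v ∈ irrelevantIdeal F

/-- The `g i` generate `I`, none of them is redundant, and no generating set of `I` has fewer
elements. -/
structure IsMinimallyGeneratedBy {m : ℕ} (I : Ideal (MvPolynomial (Fin 3) F))
    (g : Fin m → MvPolynomial (Fin 3) F) : Prop where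
  span_eq : Ideal.span (Set.range g) = I
  irredundant : ∀ i, g i ∉ Ideal.span (g '' {j | j ≠ i})
  minimum : ∀ S : Set (MvPolynomial (Fin 3) F), Ideal.span S = I → (m : ℕ∞) ≤ S.encard

end Graded

/-! ### The Klein configuration -/

section Klein

variable {F : Type*} [Field F]

/-- Coordinate vectors of the base points `(1:0:0)`, `(1:±1:0)`, `(1:±1:±c̄)`, `(c:±1:0)`,
`(1:±1:±1)`, `(c̄²:±1:±1)`, with independent signs. -/
def baseVectors (c cbar : F) : Set (Fin 3 → F) :=
  {v | ∃ s t : F, (s = 1 ∨ s = -1) ∧ (t = 1 ∨ t = -1) ∧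
    (v = ![1, 0, 0] ∨ v = ![1, s, 0] ∨ v = ![1, s, t * cbar] ∨
      v = ![c, s, 0] ∨ v = ![1, s, t] ∨ v = ![cbar ^ 2, s, t])}

/-- The Klein configuration: all points of the projective plane obtained from the base points by
permuting the coordinates. -/
def kleinConfiguration (c cbar : F) : Set (Projectivization F (Fin 3 → F)) :=
  {P | ∃ v ∈ baseVectors c cbar, ∃ σ : Equiv.Perm (Fin 3), ∃ hv : v ∘ σ ≠ 0,
    P = Projectivization.mk F (v ∘ σ) hv}

/-! The three octics; the variables `x, y, z` are `X 0, X 1, X 2`. -/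

noncomputable def octicF (c : F) : MvPolynomial (Fin 3) F :=
  X 0 * X 1 * (X 0 ^ 2 - X 1 ^ 2) *
    (4 * X 0 ^ 4 + 4 * X 1 ^ 4 + C (3 * c + 9) * X 0 ^ 2 * X 1 ^ 2 + C (5 * c - 1) * X 0 ^ 2 * X 2 ^ 2
      + C (5 * c - 1) * X 1 ^ 2 * X 2 ^ 2 + C (15 * c + 25) * X 2 ^ 4)

noncomputable def octicG (c : F) : MvPolynomial (Fin 3) F :=
  X 1 * X 2 * (X 1 ^ 2 - X 2 ^ 2) *
    (C (15 * c + 25) * X 0 ^ 4 + 4 * X 1 ^ 4 + C (5 * c - 1) * X 0 ^ 2 * X 1 ^ 2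
      + C (5 * c - 1) * X 0 ^ 2 * X 2 ^ 2 + C (3 * c + 9) * X 1 ^ 2 * X 2 ^ 2 + 4 * X 2 ^ 4)

noncomputable def octicH (c : F) : MvPolynomial (Fin 3) F :=
  X 2 * X 0 * (X 2 ^ 2 - X 0 ^ 2) *
    (4 * X 0 ^ 4 + C (15 * c + 25) * X 1 ^ 4 + C (5 * c - 1) * X 0 ^ 2 * X 1 ^ 2
      + C (3 * c + 9) * X 0 ^ 2 * X 2 ^ 2 + C (5 * c - 1) * X 1 ^ 2 * X 2 ^ 2 + 4 * X 2 ^ 4)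

/-- The first entry `z D₃` of the cubic syzygy. -/
noncomputable def cubic1 (c : F) : MvPolynomial (Fin 3) F :=
  X 2 * (C (15 * c + 21) * X 0 ^ 2 + C (15 * c + 21) * X 1 ^ 2 + C (2 * c - 10) * X 2 ^ 2)

/-- The second entry `x D₁` of the cubic syzygy. -/
noncomputable def cubic2 (c : F) : MvPolynomial (Fin 3) F :=
  X 0 * (C (2 * c - 10) * X 0 ^ 2 + C (15 * c + 21) * X 1 ^ 2 + C (15 * c + 21) * X 2 ^ 2)

/-- The third entry `y D₂` of the cubic syzygy. -/
noncomputable def cubic3 (c : F) : MvPolynomial (Fin 3) F :=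
  X 1 * (C (15 * c + 21) * X 0 ^ 2 + C (2 * c - 10) * X 1 ^ 2 + C (15 * c + 21) * X 2 ^ 2)

end Klein

end KleinConfig

/-! Write δ = -(13c+31), P for the cubic syzygy and Q for an explicit quintic syzygy
(`quinticSyzygy`).

Resolution. This is Hilbert–Burch made explicit: P × Q = δ·(f, g, h), an identity valid for every c.
The scalar δ is nonzero because its product with its conjugate is 2⁷·7. If u is any syzygy of (f, g,
h), then u × P and (f, g, h) are parallel. The ideal (f, g, h) has grade at least 2: zf + xg + yh is
δ times the product of the nine lines x, y, z, x ± y, y ± z, z ± x (`octics_combination`), while xf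
+ yg + zh restricts to a nonzero form on each of these lines (`nonic_regularMod_nineLines`). Hence u
× P is a multiple of (f, g, h), that is, of P × Q, so some u + r'Q is parallel to P. As P₁, P₂ is a
regular sequence, u + r'Q is a multiple of P (`exists_eq_combination_of_syzygy`). Minimality follows
because all syzygies have entries without constant term.

Regularity of P. Each Pᵢ is a variable times a diagonal quadric, so the claim splits into one for
each choice of factors. There it reduces to the nonvanishing of β, α + β, 2α + β and β - α, where α
= 15c+21 and β = 2c-10. Up to powers of 2 the only prime in their norms is the 7 in that of β - α =
δ.

Generation of I. All 49 points lie on the nine lines. A form p in I is peeled line by line: on the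
current line, the points not yet removed are cut out by f, g or h divided by some lines already
removed. So p agrees on that line with a multiple of this quotient, and the difference is divisible
by the equation of the line. The numbers of points removed are 8, 7, 6, then 6, 6, then 4, 4, 4, 4.
What remains is a multiple of the product of all nine lines, which lies in (f, g, h) by the identity
above (`mem_span_octics`).

Count. Scaling the first nonzero coordinate to 1 identifies the configuration with an explicit
finite set of 41 + 7 + 1 vectors (`ncard_kleinConfiguration`). -/

namespace KleinConfig

open MvPolynomial

/-! ### Non-zero-divisors modulo an ideal -/

section RegularMod

variable {R : Type*} [CommRing R]

/-- `c` is a non-zero-divisor modulo the ideal `K`. -/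
def RegularMod (K : Ideal R) (c : R) : Prop := ∀ w, c * w ∈ K → w ∈ K

theorem mem_sup_span_singleton_iff {K : Ideal R} {a w : R} :
    w ∈ K ⊔ Ideal.span {a} ↔ ∃ s, w - a * s ∈ K := by
  rw [Submodule.mem_sup]
  constructor
  · rintro ⟨k, hk, m, hm, rfl⟩
    obtain ⟨s, rfl⟩ := Ideal.mem_span_singleton'.1 hm
    exact ⟨s, by convert! hk using 1; ring⟩
  · rintro ⟨s, hs⟩
    exact ⟨_, hs, a * s, Ideal.mul_mem_right _ _ (Ideal.mem_span_singleton_self a), by ring⟩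

theorem RegularMod.mul {K : Ideal R} {c d : R} (hc : RegularMod K c) (hd : RegularMod K d) :
    RegularMod K (c * d) := fun w hw => hd w (hc _ (by rwa [← mul_assoc]))

theorem RegularMod.of_mul_sub_mem {K : Ideal R} {c d u v : R} (hd : RegularMod K d) (hv : IsUnit v)
    (h : u * c - v * d ∈ K) : RegularMod K c := by
  intro w hw
  apply hd
  have h1 : v * (d * w) ∈ K := by
    have := K.sub_mem (K.mul_mem_left u hw) (K.mul_mem_right w h)
    convert! this using 1; ring
  exact (Ideal.unit_mul_mem_iff_mem K hv).1 h1

/-- Follows from the filtration of (K, a₁)/(K, a₁a₂), a quotient of R/(K, a₂) through multiplication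
by a₁. This lets a product among the generators be replaced by each of its factors. -/
theorem RegularMod.sup_mul {K : Ideal R} {a₁ a₂ c : R}
    (h₁ : RegularMod (K ⊔ Ideal.span {a₁}) c) (h₂ : RegularMod (K ⊔ Ideal.span {a₂}) c)
    (ha : RegularMod K a₁) : RegularMod (K ⊔ Ideal.span {a₁ * a₂}) c := by
  intro w hw
  obtain ⟨s, hs⟩ := mem_sup_span_singleton_iff.1 hw
  obtain ⟨u, hu⟩ := mem_sup_span_singleton_iff.1 (h₁ w (mem_sup_span_singleton_iff.2
    ⟨a₂ * s, by rwa [← mul_assoc]⟩))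
  have h3 : c * u - a₂ * s ∈ K := by
    apply ha
    have := K.sub_mem hs (K.mul_mem_left c hu)
    convert! this using 1; ring
  obtain ⟨v, hv⟩ := mem_sup_span_singleton_iff.1 (h₂ u (mem_sup_span_singleton_iff.2 ⟨s, h3⟩))
  refine mem_sup_span_singleton_iff.2 ⟨v, ?_⟩
  have := K.add_mem hu (K.mul_mem_left a₁ hv)
  convert! this using 1; ring

/-- The half of the exchange of a regular sequence that needs no local or graded hypothesis: from cw
≡ bt mod K one gets t ≡ cu, and then c cancels in c(w - bu) ∈ K. -/
theorem RegularMod.swap {K : Ideal R} {b c : R}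
    (hb : RegularMod (K ⊔ Ideal.span {c}) b) (hc : RegularMod K c) :
    RegularMod (K ⊔ Ideal.span {b}) c := by
  intro w hw
  obtain ⟨t, ht⟩ := mem_sup_span_singleton_iff.1 hw
  obtain ⟨u, hu⟩ := mem_sup_span_singleton_iff.1 (hb t (mem_sup_span_singleton_iff.2
    ⟨w, by convert! K.neg_mem ht using 1; ring⟩))
  refine mem_sup_span_singleton_iff.2 ⟨u, hc _ ?_⟩
  have := K.add_mem ht (K.mul_mem_left b hu)
  convert! this using 1; ring

theorem RegularMod.bot [IsDomain R] {c : R} (hc : c ≠ 0) : RegularMod (⊥ : Ideal R) c := by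
  intro w hw
  simpa [hc] using hw

/-- A vector parallel to `f` is a multiple of `f` if the entries of `f` generate an ideal of grade
at least two. -/
theorem exists_eq_smul_of_parallel [IsDomain R] {f w α β : Fin 3 → R} {a b : R}
    (hw : ∀ i j, w i * f j = w j * f i)
    (ha : α 0 * f 0 + α 1 * f 1 + α 2 * f 2 = a) (hb : β 0 * f 0 + β 1 * f 1 + β 2 * f 2 = b)
    (ha0 : a ≠ 0) (hab : RegularMod (⊥ ⊔ Ideal.span {a}) b) : ∃ r, ∀ j, w j = r * f j := by
  set s := α 0 * w 0 + α 1 * w 1 + α 2 * w 2 with hs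
  set t := β 0 * w 0 + β 1 * w 1 + β 2 * w 2 with ht
  -- Pairing the parallelism with α and with β gives a·w = s·f and b·w = t·f. Comparing them yields
  -- bs = at, so a divides s because b is regular modulo a.
  have h1 : ∀ j, a * w j = s * f j := fun j => by
    rw [← ha, hs]
    linear_combination -α 0 * hw 0 j - α 1 * hw 1 j - α 2 * hw 2 j
  have h2 : ∀ j, b * w j = t * f j := fun j => by
    rw [← hb, ht]
    linear_combination -β 0 * hw 0 j - β 1 * hw 1 j - β 2 * hw 2 j
  have h3 : b * s = a * t := by
    rw [hs, ← ha]
    linear_combination α 0 * h2 0 + α 1 * h2 1 + α 2 * h2 2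
  obtain ⟨r, hr⟩ := mem_sup_span_singleton_iff.1 (hab s (mem_sup_span_singleton_iff.2
    ⟨t, by simp [h3]⟩))
  refine ⟨r, fun j => mul_left_cancel₀ ha0 ?_⟩
  have hr' : s = a * r := by simpa [sub_eq_zero] using hr
  rw [h1, hr', mul_assoc]

end RegularMod

/-! ### Regularity modulo linear forms, tested by substitution -/

section Substitution

variable {F : Type*} [Field F] {σ : Type*}

theorem sub_aeval_mem {K : Ideal (MvPolynomial σ F)} {θ : σ → MvPolynomial σ F}
    (h : ∀ i, X i - θ i ∈ K) (p : MvPolynomial σ F) : p - aeval θ p ∈ K := by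
  have : (Ideal.Quotient.mkₐ F K).comp (aeval θ) = Ideal.Quotient.mkₐ F K := by
    ext i
    simpa using (Ideal.Quotient.eq.2 (h i)).symm
  exact Ideal.Quotient.eq.1 (DFunLike.congr_fun this p).symm

/-- The hypotheses say that K is exactly the kernel of the substitution θ. The target is a domain,
so K is prime and only c ∉ K has to be checked. -/
theorem RegularMod.of_aeval_ne_zero {K : Ideal (MvPolynomial σ F)} (θ : σ → MvPolynomial σ F)
    (h : ∀ i, X i - θ i ∈ K) (hK : K ≤ RingHom.ker (aeval θ : _ →ₐ[F] MvPolynomial σ F))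
    {c : MvPolynomial σ F} (hc : aeval θ c ≠ 0) : RegularMod K c := by
  intro w hw
  have h1 : aeval θ c * aeval θ w = 0 := by rw [← map_mul]; exact hK hw
  have h2 := (mul_eq_zero.1 h1).resolve_left hc
  have := sub_aeval_mem h w
  rwa [h2, sub_zero] at this

theorem regularMod_of_linear (i : σ) [DecidableEq σ] (ℓ : MvPolynomial σ F)
    (hℓ : aeval (Function.update X i ℓ) ℓ = ℓ)
    {c : MvPolynomial σ F} (hc : aeval (Function.update X i ℓ) c ≠ 0) :
    RegularMod (⊥ ⊔ Ideal.span {X i - ℓ}) c := by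
  refine .of_aeval_ne_zero (Function.update X i ℓ) (fun j => ?_) ?_ hc
  · rcases eq_or_ne j i with rfl | hj
    · simp
    · simp [Function.update_of_ne hj]
  · rw [bot_sup_eq, Ideal.span_singleton_le_iff_mem, RingHom.mem_ker, map_sub, hℓ, aeval_X]
    simp

theorem regularMod_of_X [DecidableEq σ] {i : σ}
    {c : MvPolynomial σ F} (hc : aeval (Function.update X i 0) c ≠ (0 : MvPolynomial σ F)) :
    RegularMod (⊥ ⊔ Ideal.span {X i}) c := by
  simpa using regularMod_of_linear i 0 (by simp) hc

theorem regularMod_of_X_X [DecidableEq σ] {i j : σ} {c : MvPolynomial σ F}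
    (hc : aeval (Function.update (Function.update X i 0) j 0) c ≠ (0 : MvPolynomial σ F)) :
    RegularMod (⊥ ⊔ Ideal.span {X i} ⊔ Ideal.span {X j}) c := by
  have hi : (X i : MvPolynomial σ F) ∈ ⊥ ⊔ Ideal.span {X i} ⊔ Ideal.span {X j} :=
    Ideal.mem_sup_left (by simp)
  have hj : (X j : MvPolynomial σ F) ∈ ⊥ ⊔ Ideal.span {X i} ⊔ Ideal.span {X j} :=
    Ideal.mem_sup_right (Ideal.mem_span_singleton_self _)
  refine .of_aeval_ne_zero _ (fun k => ?_) ?_ hc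
  · rcases eq_or_ne k j with rfl | hkj
    · simpa using hj
    · rw [Function.update_of_ne hkj]
      rcases eq_or_ne k i with rfl | hki
      · simpa using hi
      · simp [Function.update_of_ne hki]
  · simp only [bot_sup_eq, sup_le_iff, Ideal.span_singleton_le_iff_mem, RingHom.mem_ker, aeval_X]
    refine ⟨?_, by simp⟩
    by_cases h : i = j <;> simp [h]

end Substitution

/-! ### Arithmetic of the roots -/

section Roots

variable {F : Type*} [Field F]

theorem two_ne_zero_of_ringChar (h2 : ringChar F ≠ 2) : (2 : F) ≠ 0 :=
  Ring.two_ne_zero h2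

theorem seven_ne_zero_of_ringChar (h7 : ringChar F ≠ 7) : (7 : F) ≠ 0 := by
  intro h
  have h1 : ringChar F ∣ 7 := ringChar.dvd (by exact_mod_cast h)
  rcases (Nat.dvd_prime (by norm_num)).1 h1 with h | h
  · exact CharP.ringChar_ne_one h
  · exact h7 h

theorem roots_mul {c cbar : F} (hc : (Polynomial.X ^ 2 + Polynomial.X + 2 : Polynomial F) =
      (Polynomial.X - Polynomial.C c) * (Polynomial.X - Polynomial.C cbar)) : c * cbar = 2 := by
  have := congrArg (Polynomial.eval 0) hc
  simp at this
  exact this.symm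

theorem roots_add {c cbar : F} (hc : (Polynomial.X ^ 2 + Polynomial.X + 2 : Polynomial F) =
      (Polynomial.X - Polynomial.C c) * (Polynomial.X - Polynomial.C cbar)) : c + cbar = -1 := by
  have h := congrArg (Polynomial.eval 1) hc
  have h' := roots_mul hc
  simp at h
  linear_combination h' + h

/-- Applied with v the conjugate of u under c ↦ -1 - c, so that u * v is the norm of u. -/
theorem ne_zero_of_mul_eq_two_pow (h2 : (2 : F) ≠ 0) {u : F} (v : F) (n : ℕ) (h : u * v = 2 ^ n) :
    u ≠ 0 := by
  rintro rfl
  rw [zero_mul] at h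
  exact pow_ne_zero n h2 h.symm

theorem beta_ne_zero (h2 : (2 : F) ≠ 0) {c : F} (hc : c ^ 2 + c + 2 = 0) : 2 * c - 10 ≠ 0 :=
  ne_zero_of_mul_eq_two_pow h2 (-2 * c - 12) 7 (by linear_combination -4 * hc)

theorem alpha_add_beta_ne_zero (h2 : (2 : F) ≠ 0) {c : F} (hc : c ^ 2 + c + 2 = 0) :
    (15 * c + 21) + (2 * c - 10) ≠ 0 :=
  ne_zero_of_mul_eq_two_pow h2 (-17 * c - 6) 9 (by linear_combination -289 * hc)

theorem two_alpha_add_beta_ne_zero (h2 : (2 : F) ≠ 0) {c : F} (hc : c ^ 2 + c + 2 = 0) :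
    2 * (15 * c + 21) + (2 * c - 10) ≠ 0 :=
  ne_zero_of_mul_eq_two_pow h2 (-32 * c) 11 (by linear_combination -1024 * hc)

/-- The norm of this scalar is 2⁷·7; this is the one place where characteristic 7 has to be
excluded. -/
theorem delta_ne_zero (h2 : (2 : F) ≠ 0) (h7 : (7 : F) ≠ 0) {c : F} (hc : c ^ 2 + c + 2 = 0) :
    (2 * c - 10) - (15 * c + 21) ≠ 0 := by
  intro h
  have : (2 : F) ^ 7 * 7 = 0 := by linear_combination (13 * c - 18) * h + 169 * hc
  exact mul_ne_zero (pow_ne_zero 7 h2) h7 this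

end Roots

/-! ### The three cubics form a regular sequence -/

section CubicSequence

variable {F : Type*} [Field F]

theorem ne_zero_of_eval {σ : Type*} {p : MvPolynomial σ F} (v : σ → F) (h : eval v p ≠ 0) :
    p ≠ 0 := by
  rintro rfl
  simp at h

/-- The diagonal quadric `α x² + α y² + α z² + (β - α) xᵢ²`. -/
noncomputable def quadric (α β : F) (i : Fin 3) : MvPolynomial (Fin 3) F :=
  C α * (X 0 ^ 2 + X 1 ^ 2 + X 2 ^ 2) + C (β - α) * X i ^ 2

variable {α β : F}

theorem quadric_regularMod_of_X_X (hβ : β ≠ 0) {i j k : Fin 3} (hij : i ≠ j) (hik : i ≠ k)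
    (hjk : j ≠ k) : RegularMod (⊥ ⊔ Ideal.span {X i} ⊔ Ideal.span {X j}) (quadric α β k) := by
  apply regularMod_of_X_X
  apply ne_zero_of_eval 1
  fin_cases i <;> fin_cases j <;> fin_cases k <;> simp_all [quadric, Function.update]

theorem X_regularMod_of_X_X {i j k : Fin 3} (hik : i ≠ k) (hjk : j ≠ k) :
    RegularMod (⊥ ⊔ Ideal.span {X i} ⊔ Ideal.span {X j}) (X k : MvPolynomial (Fin 3) F) := by
  apply regularMod_of_X_X
  apply ne_zero_of_eval 1
  simp [Function.update_of_ne hik.symm, Function.update_of_ne hjk.symm]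

theorem X_regularMod_of_X {i k : Fin 3} (hik : i ≠ k) :
    RegularMod (⊥ ⊔ Ideal.span {X i}) (X k : MvPolynomial (Fin 3) F) := by
  apply regularMod_of_X
  apply ne_zero_of_eval 1
  simp [Function.update_of_ne hik.symm]

theorem quadric_regularMod_of_X (hβ : β ≠ 0) {i k : Fin 3} (hik : i ≠ k) :
    RegularMod (⊥ ⊔ Ideal.span {X i}) (quadric α β k) := by
  apply regularMod_of_X
  apply ne_zero_of_eval (Pi.single k 1)
  fin_cases i <;> fin_cases k <;> simp_all [quadric, Function.update]

theorem quadric_ne_zero (hβ : β ≠ 0) (k : Fin 3) : quadric α β k ≠ 0 := by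
  apply ne_zero_of_eval (Pi.single k 1)
  fin_cases k <;> simp_all [quadric]

theorem X_regularMod_quadric (hβ : β ≠ 0) {i k : Fin 3} (hik : i ≠ k) :
    RegularMod (⊥ ⊔ Ideal.span {quadric α β k}) (X i) :=
  (quadric_regularMod_of_X hβ hik).swap (.bot (X_ne_zero i))

theorem X_regularMod_X_quadric (hβ : β ≠ 0) {i j k : Fin 3} (hij : i ≠ j) (hik : i ≠ k)
    (hjk : j ≠ k) : RegularMod (⊥ ⊔ Ideal.span {X i} ⊔ Ideal.span {quadric α β k}) (X j) :=
  (quadric_regularMod_of_X_X hβ hij hik hjk).swap (X_regularMod_of_X hij)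

/-- Write qⱼ, qₖ for the quadrics. Modulo xᵢ, eliminating xₖ² gives β qⱼ - α qₖ ≡ (α + β)(β - α)
xⱼ², and xⱼ is already regular. -/
theorem quadric_regularMod_X_quadric (hβ : β ≠ 0) (hs : α + β ≠ 0) (hd : β - α ≠ 0)
    {i j k : Fin 3} (hij : i ≠ j) (hik : i ≠ k) (hjk : j ≠ k) :
    RegularMod (⊥ ⊔ Ideal.span {X i} ⊔ Ideal.span {quadric α β k}) (quadric α β j) := by
  have h := X_regularMod_X_quadric (α := α) hβ hij hik hjk
  refine (h.mul h).of_mul_sub_mem (u := C β) (v := C ((α + β) * (β - α)))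
    ((isUnit_iff_ne_zero.2 (mul_ne_zero hs hd)).map C) ?_
  refine mem_sup_span_singleton_iff.2 ⟨C α, mem_sup_span_singleton_iff.2
    ⟨C (α * (β - α)) * X i, ?_⟩⟩
  have hsum : (X 0 ^ 2 + X 1 ^ 2 + X 2 ^ 2 : MvPolynomial (Fin 3) F)
      = X i ^ 2 + X j ^ 2 + X k ^ 2 := by
    fin_cases i <;> fin_cases j <;> fin_cases k <;> simp_all <;> ring
  rw [Ideal.mem_bot, quadric, quadric, hsum]
  simp only [map_mul, map_add, map_sub]
  ring

theorem X_regularMod_quadric_quadric (hβ : β ≠ 0) (hs : α + β ≠ 0) (hd : β - α ≠ 0)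
    {i j k : Fin 3} (hij : i ≠ j) (hik : i ≠ k) (hjk : j ≠ k) :
    RegularMod (⊥ ⊔ Ideal.span {quadric α β i} ⊔ Ideal.span {quadric α β k}) (X j) := by
  refine RegularMod.swap ?_ (X_regularMod_quadric hβ hij.symm)
  rw [sup_right_comm]
  exact quadric_regularMod_X_quadric hβ hs hd hjk hij.symm hik.symm

/-- Inverting the matrix with β on and α off the diagonal: (α + β) qⱼ - α (qᵢ + qₖ) = (2α + β)(β -
α) xⱼ². -/
theorem quadric_regularMod_quadric_quadric (hβ : β ≠ 0) (hs : α + β ≠ 0) (hd : β - α ≠ 0)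
    (ht : 2 * α + β ≠ 0) {i j k : Fin 3} (hij : i ≠ j) (hik : i ≠ k) (hjk : j ≠ k) :
    RegularMod (⊥ ⊔ Ideal.span {quadric α β i} ⊔ Ideal.span {quadric α β k})
      (quadric α β j) := by
  have h := X_regularMod_quadric_quadric hβ hs hd hij hik hjk
  refine (h.mul h).of_mul_sub_mem (u := C (α + β)) (v := C ((2 * α + β) * (β - α)))
    ((isUnit_iff_ne_zero.2 (mul_ne_zero ht hd)).map C) ?_
  refine mem_sup_span_singleton_iff.2 ⟨C α, mem_sup_span_singleton_iff.2 ⟨C α, ?_⟩⟩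
  have hsum : (X 0 ^ 2 + X 1 ^ 2 + X 2 ^ 2 : MvPolynomial (Fin 3) F)
      = X i ^ 2 + X j ^ 2 + X k ^ 2 := by
    fin_cases i <;> fin_cases j <;> fin_cases k <;> simp_all <;> ring
  rw [Ideal.mem_bot, quadric, quadric, quadric, hsum]
  simp only [map_mul, map_add, map_sub, map_ofNat]
  ring

/-- The difference qᵢ - qₖ equals (β - α)(xᵢ - xₖ)(xᵢ + xₖ), so it suffices that each linear factor
is regular modulo qₖ. After `RegularMod.swap` this says that qₖ does not vanish identically on xᵢ =
±xₖ, where its xₖ² coefficient is α + β. -/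
theorem quadric_regularMod_quadric (hs : α + β ≠ 0) (hd : β - α ≠ 0)
    {i k : Fin 3} (hik : i ≠ k) :
    RegularMod (⊥ ⊔ Ideal.span {quadric α β k}) (quadric α β i) := by
  have key : ∀ ε : F, ε ^ 2 = 1 →
      RegularMod (⊥ ⊔ Ideal.span {quadric α β k}) (X i - C ε * X k) := by
    intro ε hε
    refine RegularMod.swap (regularMod_of_linear i _ ?_ ?_) (.bot ?_)
    · simp [Function.update_of_ne hik.symm]
    · apply ne_zero_of_eval (Pi.single k 1)
      have : α * (ε ^ 2 + 1) + (β - α) ≠ 0 := by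
        rw [hε]; intro h; apply hs; linear_combination h
      fin_cases i <;> fin_cases k <;> simp_all [quadric, Function.update, add_comm]
    · apply ne_zero_of_eval (Pi.single i 1)
      simp [hik]
  refine ((key 1 (by simp)).mul (key (-1) (by simp))).of_mul_sub_mem (u := 1) (v := C (β - α))
    ((isUnit_iff_ne_zero.2 hd).map C) ?_
  refine mem_sup_span_singleton_iff.2 ⟨1, ?_⟩
  rw [Ideal.mem_bot, quadric, quadric]
  simp only [map_sub, map_neg, map_one]
  ring

theorem X_mul_quadric_regularMod_pair (hβ : β ≠ 0) (hs : α + β ≠ 0) (hd : β - α ≠ 0)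
    {i k : Fin 3} (hik : i ≠ k) :
    RegularMod (⊥ ⊔ Ideal.span {X k * quadric α β k}) (X i * quadric α β i) := by
  refine RegularMod.mul ?_ ?_
  · exact (X_regularMod_of_X hik.symm).sup_mul (X_regularMod_quadric hβ hik) (.bot (X_ne_zero k))
  · exact (quadric_regularMod_of_X hβ hik.symm).sup_mul (quadric_regularMod_quadric hs hd hik)
      (.bot (X_ne_zero k))

theorem X_mul_quadric_regularMod_triple (hβ : β ≠ 0) (hs : α + β ≠ 0) (hd : β - α ≠ 0)
    (ht : 2 * α + β ≠ 0) {i j k : Fin 3} (hij : i ≠ j) (hik : i ≠ k) (hjk : j ≠ k) :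
    RegularMod (⊥ ⊔ Ideal.span {X k * quadric α β k} ⊔ Ideal.span {X i * quadric α β i})
      (X j * quadric α β j) := by
  have hX : RegularMod (⊥ ⊔ Ideal.span {X k * quadric α β k}) (X i) :=
    (X_regularMod_of_X hik.symm).sup_mul (X_regularMod_quadric hβ hik) (.bot (X_ne_zero k))
  -- Splitting both products reduces regularity of p to the four choices of one factor from each;
  -- `key` is then used for p = xⱼ and for p the j-th quadric.
  have key : ∀ p, RegularMod (⊥ ⊔ Ideal.span {X i} ⊔ Ideal.span {X k}) p →
      RegularMod (⊥ ⊔ Ideal.span {X i} ⊔ Ideal.span {quadric α β k}) p →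
      RegularMod (⊥ ⊔ Ideal.span {X k} ⊔ Ideal.span {quadric α β i}) p →
      RegularMod (⊥ ⊔ Ideal.span {quadric α β i} ⊔ Ideal.span {quadric α β k}) p →
      RegularMod (⊥ ⊔ Ideal.span {X k * quadric α β k} ⊔ Ideal.span {X i * quadric α β i}) p := by
    intro p h₁ h₂ h₃ h₄
    rw [sup_right_comm] at h₃
    refine RegularMod.sup_mul ?_ ?_ hX
    · rw [sup_right_comm]
      exact h₁.sup_mul h₂ (X_regularMod_of_X hik)
    · rw [sup_right_comm]
      exact h₃.sup_mul h₄ (X_regularMod_quadric hβ hik.symm)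
  exact (key _ (X_regularMod_of_X_X hij hjk.symm) (X_regularMod_X_quadric hβ hij hik hjk)
      (X_regularMod_X_quadric hβ hjk.symm hik.symm hij.symm)
      (X_regularMod_quadric_quadric hβ hs hd hij hik hjk)).mul
    (key _ (quadric_regularMod_of_X_X hβ hik hij hjk.symm)
      (quadric_regularMod_X_quadric hβ hs hd hij hik hjk)
      (quadric_regularMod_X_quadric hβ hs hd hjk.symm hik.symm hij.symm)
      (quadric_regularMod_quadric_quadric hβ hs hd ht hij hik hjk))

theorem isSMulRegular_quotient_of_regularMod {R : Type*} [CommRing R] {K : Ideal R} {c : R}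
    (h : RegularMod K c) : IsSMulRegular (R ⧸ K) c :=
  (isSMulRegular_quotient_iff_mem_of_smul_mem K c).2 fun w hw => h w hw

theorem cubic1_eq (c : F) : cubic1 c = X 2 * quadric (15 * c + 21) (2 * c - 10) 2 := by
  simp only [cubic1, quadric, map_sub]
  ring

theorem cubic2_eq (c : F) : cubic2 c = X 0 * quadric (15 * c + 21) (2 * c - 10) 0 := by
  simp only [cubic2, quadric, map_sub]
  ring

theorem cubic3_eq (c : F) : cubic3 c = X 1 * quadric (15 * c + 21) (2 * c - 10) 1 := by
  simp only [cubic3, quadric, map_sub]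
  ring

theorem isRegular_cubics (h2 : (2 : F) ≠ 0) (h7 : (7 : F) ≠ 0) {c : F}
    (hc : c ^ 2 + c + 2 = 0) :
    RingTheory.Sequence.IsRegular (MvPolynomial (Fin 3) F) [cubic1 c, cubic2 c, cubic3 c] := by
  have hβ := beta_ne_zero h2 hc
  have hs := alpha_add_beta_ne_zero h2 hc
  have ht := two_alpha_add_beta_ne_zero h2 hc
  have hd := delta_ne_zero h2 h7 hc
  rw [cubic1_eq, cubic2_eq, cubic3_eq]
  refine ⟨⟨fun i hi => ?_⟩, ?_⟩
  · apply isSMulRegular_quotient_of_regularMod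
    simp only [List.length_cons, List.length_nil] at hi
    interval_cases i
    · simpa using RegularMod.bot (mul_ne_zero (X_ne_zero 2) (quadric_ne_zero hβ 2))
    · simpa using X_mul_quadric_regularMod_pair hβ hs hd (i := 0) (k := 2) (by decide)
    · simpa using X_mul_quadric_regularMod_triple hβ hs hd ht (i := 0) (j := 1) (k := 2)
        (by decide) (by decide) (by decide)
  -- The ideal is proper because all three cubics vanish at the origin.
  · intro h
    have h1 : (1 : MvPolynomial (Fin 3) F) ∈ RingHom.ker (eval (0 : Fin 3 → F)) := by
      have hle : Ideal.ofList [X 2 * quadric (15 * c + 21) (2 * c - 10) 2,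
          X 0 * quadric (15 * c + 21) (2 * c - 10) 0,
          X 1 * quadric (15 * c + 21) (2 * c - 10) 1] ≤ RingHom.ker (eval (0 : Fin 3 → F)) := by
        simp [Ideal.ofList, Ideal.span_le, Set.subset_def]
      apply hle
      simp only [smul_eq_mul, Ideal.mul_top] at h
      rw [← h]
      trivial
    simp at h1

end CubicSequence

/-! ### Two nonics in (f, g, h) without common factor -/

section Syzygies

variable {F : Type*} [Field F]

/-- The nine linear forms `x, y, z, x ± y, y ± z, z ± x` multiplied together. -/
noncomputable def nineLines (F : Type*) [Field F] : MvPolynomial (Fin 3) F :=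
  X 0 * X 1 * X 2 * ((X 0 - C 1 * X 1) * (X 0 - C (-1) * X 1)) *
    ((X 1 - C 1 * X 2) * (X 1 - C (-1) * X 2)) * ((X 2 - C 1 * X 0) * (X 2 - C (-1) * X 0))

/-- Used twice: as one of the two elements giving grade 2, and to absorb the final remainder when
the nine lines have been peeled off. -/
theorem octics_combination (c : F) :
    X 2 * octicF c + X 0 * octicG c + X 1 * octicH c = C (-(13 * c + 31)) * nineLines F := by
  simp only [octicF, octicG, octicH, nineLines, map_add, map_sub, map_mul, map_ofNat, map_one,
    map_neg]
  ring

/-- The nonic `x f + y g + z h`. -/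
noncomputable def nonic (c : F) : MvPolynomial (Fin 3) F :=
  X 0 * octicF c + X 1 * octicG c + X 2 * octicH c

theorem nonic_regularMod_X {c : F} (h2 : (2 : F) ≠ 0) (i : Fin 3) :
    RegularMod (⊥ ⊔ Ideal.span {X i}) (nonic c) := by
  apply regularMod_of_X
  have h4 : (4 : F) ≠ 0 := by
    have : (4 : F) = 2 * 2 := by norm_num
    rw [this]; exact mul_ne_zero h2 h2
  fin_cases i
  · have : aeval (Function.update X 0 0) (nonic c) = (X 1 * X 1 * X 2 * (X 1 - X 2) * (X 1 + X 2) *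
        (4 * X 1 ^ 4 + C (3 * c + 9) * X 1 ^ 2 * X 2 ^ 2 + 4 * X 2 ^ 4) :
        MvPolynomial (Fin 3) F) := by
      simp only [nonic, octicF, octicG, octicH, map_add, map_sub, map_mul, map_pow, aeval_X,
        algHom_C, algebraMap_eq, map_ofNat, map_one, Function.update_apply, Fin.reduceEq, if_true,
        if_false]
      ring
    refine ne_of_eq_of_ne this ?_
    repeat' apply mul_ne_zero
    all_goals first
      | exact X_ne_zero _
      | (apply ne_zero_of_eval (Pi.single 1 1); simp [h4])
  · have : aeval (Function.update X 1 0) (nonic c) = (X 2 * X 2 * X 0 * (X 2 - X 0) * (X 2 + X 0) *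
        (4 * X 0 ^ 4 + C (3 * c + 9) * X 0 ^ 2 * X 2 ^ 2 + 4 * X 2 ^ 4) :
        MvPolynomial (Fin 3) F) := by
      simp only [nonic, octicF, octicG, octicH, map_add, map_sub, map_mul, map_pow, aeval_X,
        algHom_C, algebraMap_eq, map_ofNat, map_one, Function.update_apply, Fin.reduceEq, if_true,
        if_false]
      ring
    refine ne_of_eq_of_ne this ?_
    repeat' apply mul_ne_zero
    all_goals first
      | exact X_ne_zero _
      | (apply ne_zero_of_eval (Pi.single 2 1); simp [h4])
  · have : aeval (Function.update X 2 0) (nonic c) = (X 0 * X 0 * X 1 * (X 0 - X 1) * (X 0 + X 1) *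
        (4 * X 0 ^ 4 + 4 * X 1 ^ 4 + C (3 * c + 9) * X 0 ^ 2 * X 1 ^ 2) :
        MvPolynomial (Fin 3) F) := by
      simp only [nonic, octicF, octicG, octicH, map_add, map_sub, map_mul, map_pow, aeval_X,
        algHom_C, algebraMap_eq, map_ofNat, map_one, Function.update_apply, Fin.reduceEq, if_true,
        if_false]
      ring
    refine ne_of_eq_of_ne this ?_
    repeat' apply mul_ne_zero
    all_goals first
      | exact X_ne_zero _
      | (apply ne_zero_of_eval (Pi.single 0 1); simp [h4])

/-- On x = εy, f vanishes and the quartic cofactors of g and h coincide, so yg + zh factors with the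
extra linear form y - εz. The common cofactor is nonzero because its z⁴ coefficient is 4. The other
diagonals follow cyclically. -/
theorem nonic_regularMod_diagonal {c : F} (h2 : (2 : F) ≠ 0) {ε : F} (hε : ε ^ 2 = 1) (i : Fin 3) :
    RegularMod (⊥ ⊔ Ideal.span {X i - C ε * X (i + 1)}) (nonic c) := by
  have hεC : (C ε ^ 2 : MvPolynomial (Fin 3) F) = 1 := by rw [← map_pow, hε, map_one]
  have hε0 : ε ≠ 0 := by rintro rfl; simp at hε
  have h4 : (4 : F) ≠ 0 := by
    have : (4 : F) = 2 * 2 := by norm_num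
    rw [this]; exact mul_ne_zero h2 h2
  apply regularMod_of_linear
  · simp
  fin_cases i
  · have : aeval (Function.update X 0 (C ε * X 1)) (nonic c) =
        (X 1 * X 2 * (X 1 - X 2) * (X 1 + X 2) * (X 1 - C ε * X 2) *
        (C (15 * c + 25) * X 1 ^ 4 + 4 * X 1 ^ 4 + C (5 * c - 1) * X 1 ^ 2 * X 1 ^ 2
      + C (5 * c - 1) * X 1 ^ 2 * X 2 ^ 2 + C (3 * c + 9) * X 1 ^ 2 * X 2 ^ 2 + 4 * X 2 ^ 4) :
        MvPolynomial (Fin 3) F) := by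
      simp only [nonic, octicF, octicG, octicH, map_add, map_sub, map_mul, map_pow, aeval_X,
        algHom_C, algebraMap_eq, map_ofNat, map_one, Function.update_apply, Fin.reduceEq, if_true,
        if_false]
      grind
    refine ne_of_eq_of_ne this ?_
    repeat' apply mul_ne_zero
    all_goals first
      | exact X_ne_zero _
      | (apply ne_zero_of_eval (Pi.single 2 1); simp [h4, hε0])
  · have : aeval (Function.update X 1 (C ε * X 2)) (nonic c) =
        (X 2 * X 0 * (X 2 - X 0) * (X 2 + X 0) * (X 2 - C ε * X 0) *
        (C (15 * c + 25) * X 2 ^ 4 + 4 * X 2 ^ 4 + C (5 * c - 1) * X 2 ^ 2 * X 2 ^ 2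
      + C (5 * c - 1) * X 2 ^ 2 * X 0 ^ 2 + C (3 * c + 9) * X 2 ^ 2 * X 0 ^ 2 + 4 * X 0 ^ 4) :
        MvPolynomial (Fin 3) F) := by
      simp only [nonic, octicF, octicG, octicH, map_add, map_sub, map_mul, map_pow, aeval_X,
        algHom_C, algebraMap_eq, map_ofNat, map_one, Function.update_apply, Fin.reduceEq, if_true,
        if_false]
      grind
    refine ne_of_eq_of_ne this ?_
    repeat' apply mul_ne_zero
    all_goals first
      | exact X_ne_zero _
      | (apply ne_zero_of_eval (Pi.single 0 1); simp [h4, hε0])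
  · have : aeval (Function.update X 2 (C ε * X 0)) (nonic c) =
        (X 0 * X 1 * (X 0 - X 1) * (X 0 + X 1) * (X 0 - C ε * X 1) *
        (C (15 * c + 25) * X 0 ^ 4 + 4 * X 0 ^ 4 + C (5 * c - 1) * X 0 ^ 2 * X 0 ^ 2
      + C (5 * c - 1) * X 0 ^ 2 * X 1 ^ 2 + C (3 * c + 9) * X 0 ^ 2 * X 1 ^ 2 + 4 * X 1 ^ 4) :
        MvPolynomial (Fin 3) F) := by
      simp only [nonic, octicF, octicG, octicH, map_add, map_sub, map_mul, map_pow, aeval_X,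
        algHom_C, algebraMap_eq, map_ofNat, map_one, Function.update_apply, Fin.reduceEq, if_true,
        if_false]
      grind
    refine ne_of_eq_of_ne this ?_
    repeat' apply mul_ne_zero
    all_goals first
      | exact X_ne_zero _
      | (apply ne_zero_of_eval (Pi.single 1 1); simp [h4, hε0])

theorem nonic_ne_zero {c : F} (h2 : (2 : F) ≠ 0) : nonic c ≠ 0 := by
  intro h
  -- If the nonic were 0, its regularity modulo x would force 1 ∈ (x).
  have := nonic_regularMod_X (c := c) h2 0 1 (by simp [h])
  rw [bot_sup_eq, Ideal.mem_span_singleton] at this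
  obtain ⟨q, hq⟩ := this
  simpa using congrArg (eval 0) hq

theorem X_sub_C_mul_X_ne_zero (ε : F) (i : Fin 3) : X i - C ε * X (i + 1) ≠ 0 :=
  ne_zero_of_eval (Pi.single i 1) (by simp)

theorem nineLines_ne_zero : nineLines F ≠ 0 := by
  have hX := fun i : Fin 3 => X_ne_zero (R := F) i
  have hD := fun i => mul_ne_zero (X_sub_C_mul_X_ne_zero (1 : F) i) (X_sub_C_mul_X_ne_zero (-1 : F) i)
  exact mul_ne_zero (mul_ne_zero (mul_ne_zero (mul_ne_zero (mul_ne_zero (hX 0) (hX 1)) (hX 2))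
    (hD 0)) (hD 1)) (hD 2)

theorem nonic_regularMod_nineLines {c : F} (h2 : (2 : F) ≠ 0) :
    RegularMod (⊥ ⊔ Ideal.span {nineLines F}) (nonic c) := by
  have hX : ∀ i, RegularMod (⊥ ⊔ Ideal.span {nonic c}) (X i) := fun i =>
    (nonic_regularMod_X h2 i).swap (.bot (X_ne_zero i))
  have hD : ∀ (i : Fin 3) (ε : F), ε ^ 2 = 1 →
      RegularMod (⊥ ⊔ Ideal.span {nonic c}) (X i - C ε * X (i + 1)) := fun i ε hε =>
    (nonic_regularMod_diagonal h2 hε i).swap (.bot (X_sub_C_mul_X_ne_zero ε i))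
  have hE : ∀ i : Fin 3, RegularMod (⊥ ⊔ Ideal.span {nonic c})
      ((X i - C 1 * X (i + 1)) * (X i - C (-1) * X (i + 1))) := fun i =>
    (hD i 1 (by simp)).mul (hD i (-1) (by simp))
  have := (((((hX 0).mul (hX 1)).mul (hX 2)).mul (hE 0)).mul (hE 1)).mul (hE 2)
  exact RegularMod.swap this (.bot (nonic_ne_zero h2))

end Syzygies

/-! ### The Hilbert–Burch resolution and minimality -/

section Resolution

variable {F : Type*} [Field F]

/-- The entries of the quintic syzygy without the linear factor. -/
noncomputable def quartic (c : F) (i : Fin 3) : MvPolynomial (Fin 3) F :=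
  C (15 * c + 25) * (X 0 ^ 2 + X 1 ^ 2 + X 2 ^ 2) ^ 2 - C (10 * c + 30) *
    (X 0 ^ 2 * X 1 ^ 2 + X 0 ^ 2 * X 2 ^ 2 + X 1 ^ 2 * X 2 ^ 2) - C (13 * c + 31) * X i ^ 4

/-- The quintic syzygy. -/
noncomputable def quinticSyzygy (c : F) : Fin 3 → MvPolynomial (Fin 3) F :=
  ![X 2 * quartic c 2, X 0 * quartic c 0, X 1 * quartic c 1]

theorem cubic_syzygy (c : F) :
    cubic1 c * octicF c + cubic2 c * octicG c + cubic3 c * octicH c = 0 := by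
  simp only [octicF, octicG, octicH, cubic1, cubic2, cubic3, map_add, map_sub, map_mul, map_ofNat,
    map_one]
  ring

/-- This and the next two identities are the Hilbert–Burch minors: P × Q = δ·(f, g, h). -/
theorem cross_eq_octicF (c : F) : cubic2 c * quinticSyzygy c 2 - cubic3 c * quinticSyzygy c 1 =
    C (-(13 * c + 31)) * octicF c := by
  simp only [octicF, quinticSyzygy, quartic, cubic2, cubic3, map_add, map_sub, map_mul, map_ofNat,
    map_one, map_neg, Matrix.cons_val]
  ring

theorem cross_eq_octicG (c : F) : cubic3 c * quinticSyzygy c 0 - cubic1 c * quinticSyzygy c 2 =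
    C (-(13 * c + 31)) * octicG c := by
  simp only [octicG, quinticSyzygy, quartic, cubic1, cubic3, map_add, map_sub, map_mul, map_ofNat,
    map_one, map_neg, Matrix.cons_val]
  ring

theorem cross_eq_octicH (c : F) : cubic1 c * quinticSyzygy c 1 - cubic2 c * quinticSyzygy c 0 =
    C (-(13 * c + 31)) * octicH c := by
  simp only [octicH, quinticSyzygy, quartic, cubic1, cubic2, map_add, map_sub, map_mul, map_ofNat,
    map_one, map_neg, Matrix.cons_val]
  ring

theorem delta_ne_zero' (h2 : (2 : F) ≠ 0) (h7 : (7 : F) ≠ 0) {c : F} (hc : c ^ 2 + c + 2 = 0) :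
    -(13 * c + 31) ≠ 0 := by
  have := delta_ne_zero h2 h7 hc
  intro h
  apply this
  linear_combination h

theorem quintic_syzygy (h2 : (2 : F) ≠ 0) (h7 : (7 : F) ≠ 0) {c : F} (hc : c ^ 2 + c + 2 = 0) :
    quinticSyzygy c 0 * octicF c + quinticSyzygy c 1 * octicG c + quinticSyzygy c 2 * octicH c
      = 0 := by
  have hδ : (C (-(13 * c + 31)) : MvPolynomial (Fin 3) F) ≠ 0 :=
    C_ne_zero.2 (delta_ne_zero' h2 h7 hc)
  -- δ times the claim is Q · (P × Q), a determinant with a repeated column.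
  refine (mul_eq_zero.1 (?_ : C (-(13 * c + 31)) * _ = 0)).resolve_left hδ
  linear_combination -quinticSyzygy c 0 * cross_eq_octicF c - quinticSyzygy c 1 * cross_eq_octicG c
    - quinticSyzygy c 2 * cross_eq_octicH c

theorem octicF_ne_zero (h2 : (2 : F) ≠ 0) (c : F) : octicF c ≠ 0 := by
  have h4 : (4 : F) ≠ 0 := by
    have : (4 : F) = 2 * 2 := by norm_num
    rw [this]; exact mul_ne_zero h2 h2
  rw [octicF, sq_sub_sq]
  repeat' apply mul_ne_zero
  all_goals first
    | exact X_ne_zero _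
    | (apply ne_zero_of_eval (Pi.single 0 1); simp [h4])

theorem cubic1_ne_zero (h2 : (2 : F) ≠ 0) {c : F} (hc : c ^ 2 + c + 2 = 0) : cubic1 c ≠ 0 := by
  rw [cubic1_eq]
  exact mul_ne_zero (X_ne_zero _) (quadric_ne_zero (beta_ne_zero h2 hc) _)

theorem exists_eq_combination_of_syzygy (h2 : (2 : F) ≠ 0) (h7 : (7 : F) ≠ 0) {c : F}
    (hc : c ^ 2 + c + 2 = 0) {u : Fin 3 → MvPolynomial (Fin 3) F}
    (hu : u 0 * octicF c + u 1 * octicG c + u 2 * octicH c = 0) :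
    ∃ s t, u 0 = s * cubic1 c + t * quinticSyzygy c 0 ∧ u 1 = s * cubic2 c + t * quinticSyzygy c 1 ∧
      u 2 = s * cubic3 c + t * quinticSyzygy c 2 := by
  have hδ := delta_ne_zero' h2 h7 hc
  have hP := cubic_syzygy c
  -- Here w = u × P. Both u and P are orthogonal to (f, g, h), which makes w parallel to it. The
  -- vectors α and β realise the two nonics as combinations of the octics.
  obtain ⟨r, hr⟩ := exists_eq_smul_of_parallel
    (f := ![octicF c, octicG c, octicH c])
    (w := ![u 1 * cubic3 c - u 2 * cubic2 c, u 2 * cubic1 c - u 0 * cubic3 c,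
      u 0 * cubic2 c - u 1 * cubic1 c])
    (α := ![X 2, X 0, X 1]) (β := ![X 0, X 1, X 2])
    (a := C (-(13 * c + 31)) * nineLines F) (b := nonic c)
    (by
      intro i j
      fin_cases i <;> fin_cases j <;>
        simp only [Fin.zero_eta, Fin.mk_one, Fin.reduceFinMk, Matrix.cons_val]
      · linear_combination cubic3 c * hu - u 2 * hP
      · linear_combination -cubic2 c * hu + u 1 * hP
      · linear_combination -cubic3 c * hu + u 2 * hP
      · linear_combination cubic1 c * hu - u 0 * hP
      · linear_combination cubic2 c * hu - u 1 * hP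
      · linear_combination -cubic1 c * hu + u 0 * hP)
    (octics_combination c) rfl
    (mul_ne_zero (C_ne_zero.2 hδ) nineLines_ne_zero)
    (by
      have := nonic_regularMod_nineLines (c := c) h2
      rwa [Ideal.span_singleton_mul_left_unit ((isUnit_iff_ne_zero.2 hδ).map C)])
  set d : MvPolynomial (Fin 3) F := C (-(13 * c + 31))⁻¹ with hd
  have hdd : d * C (-(13 * c + 31)) = 1 := by
    rw [hd, ← C_mul, inv_mul_cancel₀ hδ, C_1]
  have hr0 := hr 0
  have hr1 := hr 1
  have hr2 := hr 2
  simp only [Matrix.cons_val] at hr0 hr1 hr2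
  have e0 : u 1 * cubic3 c - u 2 * cubic2 c =
      d * r * (cubic2 c * quinticSyzygy c 2 - cubic3 c * quinticSyzygy c 1) := by
    linear_combination hr0 - d * r * cross_eq_octicF c - r * octicF c * hdd
  have e1 : u 2 * cubic1 c - u 0 * cubic3 c =
      d * r * (cubic3 c * quinticSyzygy c 0 - cubic1 c * quinticSyzygy c 2) := by
    linear_combination hr1 - d * r * cross_eq_octicG c - r * octicG c * hdd
  have e2 : u 0 * cubic2 c - u 1 * cubic1 c =
      d * r * (cubic1 c * quinticSyzygy c 1 - cubic2 c * quinticSyzygy c 0) := by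
    linear_combination hr2 - d * r * cross_eq_octicH c - r * octicH c * hdd
  -- Now u × P = δ⁻¹r·(P × Q), so (u + δ⁻¹rQ) × P = 0; the regular pair P₁, P₂ supplies the grade
  -- condition.
  obtain ⟨s, hs⟩ := exists_eq_smul_of_parallel
    (f := ![cubic1 c, cubic2 c, cubic3 c])
    (w := fun i => u i + d * r * quinticSyzygy c i)
    (α := ![1, 0, 0]) (β := ![0, 1, 0]) (a := cubic1 c) (b := cubic2 c)
    (by
      intro i j
      fin_cases i <;> fin_cases j <;>
        simp only [Fin.zero_eta, Fin.mk_one, Fin.reduceFinMk, Matrix.cons_val]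
      · linear_combination e2
      · linear_combination -e1
      · linear_combination -e2
      · linear_combination e0
      · linear_combination e1
      · linear_combination -e0)
    (by simp) (by simp) (cubic1_ne_zero h2 hc)
    (by
      rw [cubic1_eq, cubic2_eq]
      exact X_mul_quadric_regularMod_pair (beta_ne_zero h2 hc) (alpha_add_beta_ne_zero h2 hc)
        (delta_ne_zero h2 h7 hc) (by decide))
  have hs0 := hs 0
  have hs1 := hs 1
  have hs2 := hs 2
  simp only [Matrix.cons_val] at hs0 hs1 hs2
  exact ⟨s, -(d * r), by linear_combination hs0, by linear_combination hs1,
    by linear_combination hs2⟩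

theorem coefficients_eq_zero (h2 : (2 : F) ≠ 0) (h7 : (7 : F) ≠ 0) {c : F}
    (hc : c ^ 2 + c + 2 = 0) {s t : MvPolynomial (Fin 3) F}
    (h0 : s * cubic1 c + t * quinticSyzygy c 0 = 0) (h1 : s * cubic2 c + t * quinticSyzygy c 1 = 0)
    (h2' : s * cubic3 c + t * quinticSyzygy c 2 = 0) : s = 0 ∧ t = 0 := by
  have hδ : (C (-(13 * c + 31)) : MvPolynomial (Fin 3) F) ≠ 0 :=
    C_ne_zero.2 (delta_ne_zero' h2 h7 hc)
  have ht : t = 0 := by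
    refine (mul_eq_zero.1 (?_ : _ * (C (-(13 * c + 31)) * octicF c) = 0)).resolve_right
      (mul_ne_zero hδ (octicF_ne_zero h2 c))
    linear_combination -t * cross_eq_octicF c + cubic2 c * h2' - cubic3 c * h1
  subst ht
  simpa [cubic1_ne_zero h2 hc] using h0

theorem isHomogeneous_C_mul_X_sq_mul_X_sq (a : F) (i j : Fin 3) :
    (C a * X i ^ 2 * X j ^ 2 : MvPolynomial (Fin 3) F).IsHomogeneous 4 :=
  (isHomogeneous_C_mul_X_pow a i 2).mul (isHomogeneous_X_pow j 2)

theorem isHomogeneous_octicF (c : F) : (octicF c).IsHomogeneous 8 := by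
  have h4 : (4 : MvPolynomial (Fin 3) F) = C 4 := (map_ofNat C 4).symm
  rw [octicF, h4]
  exact (((isHomogeneous_X F 0).mul (isHomogeneous_X F 1)).mul
    ((isHomogeneous_X_pow 0 2).sub (isHomogeneous_X_pow 1 2))).mul
    ((((((isHomogeneous_C_mul_X_pow _ _ 4).add (isHomogeneous_C_mul_X_pow _ _ 4)).add
      (isHomogeneous_C_mul_X_sq_mul_X_sq _ _ _)).add (isHomogeneous_C_mul_X_sq_mul_X_sq _ _ _)).add
      (isHomogeneous_C_mul_X_sq_mul_X_sq _ _ _)).add (isHomogeneous_C_mul_X_pow _ _ 4))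

theorem isHomogeneous_octicG (c : F) : (octicG c).IsHomogeneous 8 := by
  have h4 : (4 : MvPolynomial (Fin 3) F) = C 4 := (map_ofNat C 4).symm
  rw [octicG, h4]
  exact (((isHomogeneous_X F 1).mul (isHomogeneous_X F 2)).mul
    ((isHomogeneous_X_pow 1 2).sub (isHomogeneous_X_pow 2 2))).mul
    ((((((isHomogeneous_C_mul_X_pow _ _ 4).add (isHomogeneous_C_mul_X_pow _ _ 4)).add
      (isHomogeneous_C_mul_X_sq_mul_X_sq _ _ _)).add (isHomogeneous_C_mul_X_sq_mul_X_sq _ _ _)).add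
      (isHomogeneous_C_mul_X_sq_mul_X_sq _ _ _)).add (isHomogeneous_C_mul_X_pow _ _ 4))

theorem isHomogeneous_octicH (c : F) : (octicH c).IsHomogeneous 8 := by
  have h4 : (4 : MvPolynomial (Fin 3) F) = C 4 := (map_ofNat C 4).symm
  rw [octicH, h4]
  exact (((isHomogeneous_X F 2).mul (isHomogeneous_X F 0)).mul
    ((isHomogeneous_X_pow 2 2).sub (isHomogeneous_X_pow 0 2))).mul
    ((((((isHomogeneous_C_mul_X_pow _ _ 4).add (isHomogeneous_C_mul_X_pow _ _ 4)).add
      (isHomogeneous_C_mul_X_sq_mul_X_sq _ _ _)).add (isHomogeneous_C_mul_X_sq_mul_X_sq _ _ _)).add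
      (isHomogeneous_C_mul_X_sq_mul_X_sq _ _ _)).add (isHomogeneous_C_mul_X_pow _ _ 4))

theorem isHomogeneous_X_mul_quadric (α β : F) (i : Fin 3) :
    (X i * quadric α β i).IsHomogeneous 3 :=
  (isHomogeneous_X F i).mul ((IsHomogeneous.C_mul (((isHomogeneous_X_pow 0 2).add
    (isHomogeneous_X_pow 1 2)).add (isHomogeneous_X_pow 2 2)) α).add
    (isHomogeneous_C_mul_X_pow _ _ 2))

theorem isHomogeneous_X_mul_quartic (c : F) (i : Fin 3) :
    (X i * quartic c i).IsHomogeneous 5 := by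
  have h : ∀ j k : Fin 3, (X j ^ 2 * X k ^ 2 : MvPolynomial (Fin 3) F).IsHomogeneous 4 :=
    fun j k => (isHomogeneous_X_pow j 2).mul (isHomogeneous_X_pow k 2)
  exact (isHomogeneous_X F i).mul (((IsHomogeneous.C_mul ((((isHomogeneous_X_pow 0 2).add
    (isHomogeneous_X_pow 1 2)).add (isHomogeneous_X_pow 2 2)).pow 2) _).sub
    (IsHomogeneous.C_mul (((h 0 1).add (h 0 2)).add (h 1 2)) _)).sub
    (isHomogeneous_C_mul_X_pow _ _ 4))

theorem isHomogeneous_cubics (c : F) (i : Fin 3) :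
    (![cubic1 c, cubic2 c, cubic3 c] i).IsHomogeneous 3 := by
  fin_cases i
  · simpa [cubic1_eq] using isHomogeneous_X_mul_quadric _ _ _
  · simpa [cubic2_eq] using isHomogeneous_X_mul_quadric _ _ _
  · simpa [cubic3_eq] using isHomogeneous_X_mul_quadric _ _ _

theorem isHomogeneous_quinticSyzygy (c : F) (i : Fin 3) :
    (quinticSyzygy c i).IsHomogeneous 5 := by
  fin_cases i <;> exact isHomogeneous_X_mul_quartic _ _

/-- Multiplication by a form of degree e maps R(-(a+e)) to R(-a). In degrees a ≤ d < a + e the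
source is zero, and its image counts as the zero form of degree d - a. -/
theorem mul_mem_shift {σ : Type*} {a e d : ℕ} {p q : MvPolynomial σ F}
    (hp : (a + e ≤ d ∧ p.IsHomogeneous (d - (a + e))) ∨ (d < a + e ∧ p = 0))
    (hq : q.IsHomogeneous e) :
    (a ≤ d ∧ (p * q).IsHomogeneous (d - a)) ∨ (d < a ∧ p * q = 0) := by
  rcases hp with ⟨h, hp⟩ | ⟨h, rfl⟩
  · refine .inl ⟨by omega, ?_⟩
    have := hp.mul hq
    rwa [show d - (a + e) + e = d - a by omega] at this
  · rw [zero_mul]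
    rcases le_or_gt a d with h | h
    · exact .inl ⟨h, isHomogeneous_zero _ _ _⟩
    · exact .inr ⟨h, rfl⟩

theorem add_mem_shift {σ : Type*} {a d : ℕ} {p q : MvPolynomial σ F}
    (hp : (a ≤ d ∧ p.IsHomogeneous (d - a)) ∨ (d < a ∧ p = 0))
    (hq : (a ≤ d ∧ q.IsHomogeneous (d - a)) ∨ (d < a ∧ q = 0)) :
    (a ≤ d ∧ (p + q).IsHomogeneous (d - a)) ∨ (d < a ∧ p + q = 0) := by
  rcases hp with ⟨h, hp⟩ | ⟨h, rfl⟩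
  · exact .inl ⟨h, hp.add (hq.resolve_right fun h' => by omega).2⟩
  · exact .inr ⟨h, by rw [(hq.resolve_left fun h' => by omega).2, zero_add]⟩

theorem mem_irrelevantIdeal_of_isHomogeneous {p : MvPolynomial (Fin 3) F} {n : ℕ}
    (hp : p.IsHomogeneous n) (hn : n ≠ 0) : p ∈ irrelevantIdeal F := by
  have h := sub_aeval_mem (K := irrelevantIdeal F) (θ := 0)
    (fun i => by
      rw [Pi.zero_apply, sub_zero]
      exact Ideal.subset_span ⟨i, rfl⟩) p
  rwa [aeval_zero, constantCoeff_eq, hp.coeff_eq_zero (by simpa using hn.symm), map_zero,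
    sub_zero] at h

theorem isMinimalGradedFreeResolution_octics (h2 : (2 : F) ≠ 0) (h7 : (7 : F) ≠ 0) {c : F}
    (hc : c ^ 2 + c + 2 = 0) :
    IsMinimalGradedFreeResolution (Ideal.span (Set.range ![octicF c, octicG c, octicH c]))
      ![8, 8, 8] ![11, 13]
      (Fintype.linearCombination (MvPolynomial (Fin 3) F)
        ![![cubic1 c, cubic2 c, cubic3 c], quinticSyzygy c])
      (Fintype.linearCombination (MvPolynomial (Fin 3) F) ![octicF c, octicG c, octicH c]) where
  graded_left d v hv i := by
    have h0 : (8 + 3 ≤ d ∧ (v 0).IsHomogeneous (d - (8 + 3))) ∨ (d < 8 + 3 ∧ v 0 = 0) := hv 0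
    have h1 : (8 + 5 ≤ d ∧ (v 1).IsHomogeneous (d - (8 + 5))) ∨ (d < 8 + 5 ∧ v 1 = 0) := hv 1
    have := add_mem_shift (mul_mem_shift h0 (isHomogeneous_cubics c i))
      (mul_mem_shift h1 (isHomogeneous_quinticSyzygy c i))
    have h8 : (![8, 8, 8] : Fin 3 → ℕ) i = 8 := by fin_cases i <;> rfl
    rw [h8]
    simpa [Fintype.linearCombination_apply, Fin.sum_univ_two] using this
  graded_right d v hv := by
    have h0 : (0 + 8 ≤ d ∧ (v 0).IsHomogeneous (d - (0 + 8))) ∨ (d < 0 + 8 ∧ v 0 = 0) := hv 0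
    have h1 : (0 + 8 ≤ d ∧ (v 1).IsHomogeneous (d - (0 + 8))) ∨ (d < 0 + 8 ∧ v 1 = 0) := hv 1
    have h2 : (0 + 8 ≤ d ∧ (v 2).IsHomogeneous (d - (0 + 8))) ∨ (d < 0 + 8 ∧ v 2 = 0) := hv 2
    have := add_mem_shift (add_mem_shift (mul_mem_shift h0 (isHomogeneous_octicF c))
      (mul_mem_shift h1 (isHomogeneous_octicG c))) (mul_mem_shift h2 (isHomogeneous_octicH c))
    simpa [Fintype.linearCombination_apply, Fin.sum_univ_three] using this
  injective := by
    rw [injective_iff_map_eq_zero]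
    intro v hv
    rw [Fintype.linearCombination_apply, Fin.sum_univ_two] at hv
    obtain ⟨hs, ht⟩ := coefficients_eq_zero h2 h7 hc (by simpa using congrFun hv 0)
      (by simpa using congrFun hv 1) (by simpa using congrFun hv 2)
    ext1 i
    fin_cases i
    · exact hs
    · exact ht
  exact := by
    intro u
    simp only [Fintype.linearCombination_apply, Fin.sum_univ_three, Fin.sum_univ_two,
      Matrix.cons_val, smul_eq_mul, Set.mem_range]
    constructor
    · intro hu
      obtain ⟨s, t, h0, h1, h2⟩ := exists_eq_combination_of_syzygy h2 h7 hc hu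
      refine ⟨![s, t], ?_⟩
      ext1 i
      fin_cases i <;> simp [h0, h1, h2]
    · rintro ⟨v, rfl⟩
      simp only [Pi.add_apply, Pi.smul_apply, smul_eq_mul, Matrix.cons_val]
      linear_combination v 0 * cubic_syzygy c + v 1 * quintic_syzygy h2 h7 hc
  range_eq := by
    rw [Fintype.range_linearCombination]
  minimal_left v i := by
    rw [Fintype.linearCombination_apply, Fin.sum_univ_two]
    exact Ideal.add_mem _
      (Ideal.mul_mem_left _ _
        (mem_irrelevantIdeal_of_isHomogeneous (isHomogeneous_cubics c i) (by simp)))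
      (Ideal.mul_mem_left _ _
        (mem_irrelevantIdeal_of_isHomogeneous (isHomogeneous_quinticSyzygy c i) (by simp)))
  minimal_right v := by
    rw [Fintype.linearCombination_apply, Fin.sum_univ_three]
    exact Ideal.add_mem _ (Ideal.add_mem _
      (Ideal.mul_mem_left _ _
        (mem_irrelevantIdeal_of_isHomogeneous (isHomogeneous_octicF c) (by simp)))
      (Ideal.mul_mem_left _ _
        (mem_irrelevantIdeal_of_isHomogeneous (isHomogeneous_octicG c) (by simp))))
      (Ideal.mul_mem_left _ _
        (mem_irrelevantIdeal_of_isHomogeneous (isHomogeneous_octicH c) (by simp)))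

theorem eval_zero_of_mem_irrelevantIdeal {p : MvPolynomial (Fin 3) F}
    (hp : p ∈ irrelevantIdeal F) : eval 0 p = 0 := by
  have h : irrelevantIdeal F ≤ RingHom.ker (eval (0 : Fin 3 → F)) := by
    rw [irrelevantIdeal, Ideal.span_le]
    rintro _ ⟨i, rfl⟩
    simp
  exact h hp

/-- Generators whose syzygies have all entries in the irrelevant ideal are minimal. -/
theorem isMinimallyGeneratedBy_of_syzygies {m : ℕ} {g : Fin m → MvPolynomial (Fin 3) F}
    (h : ∀ u : Fin m → MvPolynomial (Fin 3) F, ∑ i, u i * g i = 0 → ∀ i, eval 0 (u i) = 0) :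
    IsMinimallyGeneratedBy (Ideal.span (Set.range g)) g where
  span_eq := rfl
  irredundant i hi := by
    have hle : Ideal.span (g '' {j | j ≠ i}) ≤ Ideal.span (Set.range (Function.update g i 0)) := by
      apply Ideal.span_mono
      rintro _ ⟨j, hj, rfl⟩
      exact ⟨j, Function.update_of_ne hj _ _⟩
    obtain ⟨u, hu⟩ := Ideal.mem_span_range_iff_exists_fun.1 (hle hi)
    -- A redundant generator gives a syzygy whose i-th entry is the unit -1.
    have := h (Function.update u i (-1)) (by
      rw [← Finset.add_sum_erase _ _ (Finset.mem_univ i)] at hu ⊢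
      rw [Function.update_self] at hu ⊢
      have hsum : ∑ j ∈ Finset.univ.erase i, Function.update u i (-1) j * g j =
          ∑ j ∈ Finset.univ.erase i, u j * Function.update g i 0 j :=
        Finset.sum_congr rfl fun j hj => by
          rw [Function.update_of_ne (Finset.ne_of_mem_erase hj),
            Function.update_of_ne (Finset.ne_of_mem_erase hj)]
      rw [hsum]
      linear_combination hu) i
    simp at this
  minimum S hS := by
    by_contra! hlt
    have hfin : S.Finite := Set.encard_lt_top_iff.1 (hlt.trans (ENat.natCast_lt_top m))
    have : Fintype S := hfin.fintype
    have hcard : Fintype.card S < m := by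
      rw [← Set.coe_fintypeCard] at hlt
      exact_mod_cast hlt
    have hA : ∀ i, ∃ a : S → MvPolynomial (Fin 3) F, ∑ s, a s * (s : MvPolynomial (Fin 3) F) = g i := by
      intro i
      apply Ideal.mem_span_range_iff_exists_fun.1
      rw [Subtype.range_coe, hS]
      exact Ideal.subset_span ⟨i, rfl⟩
    have hB : ∀ s : S, ∃ b : Fin m → MvPolynomial (Fin 3) F, ∑ k, b k * g k = s := by
      intro s
      apply Ideal.mem_span_range_iff_exists_fun.1
      rw [← hS]
      exact Ideal.subset_span s.2
    choose A hA using hA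
    choose B hB using hB
    -- The rows of AB - 1 are syzygies, hence vanish at the origin. So the identity of size m
    -- factors over F through a space of dimension |S| < m, which contradicts its rank.
    have key : (Matrix.of fun i s => eval 0 (A i s)) * (Matrix.of fun s k => eval 0 (B s k)) =
        (1 : Matrix (Fin m) (Fin m) F) := by
      ext i k
      have hu := h (fun k => ∑ s, A i s * B s k - if k = i then 1 else 0) (by
        simp only [sub_mul, Finset.sum_sub_distrib, Finset.sum_mul, ite_mul, one_mul, zero_mul,
          Finset.sum_ite_eq', Finset.mem_univ, if_true]
        rw [Finset.sum_comm, sub_eq_zero, ← hA i]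
        refine Finset.sum_congr rfl fun s _ => ?_
        rw [← hB s, Finset.mul_sum]
        exact Finset.sum_congr rfl fun k _ => by ring) k
      simp only [map_sub, map_sum, map_mul, sub_eq_zero] at hu
      rw [Matrix.mul_apply]
      simp only [Matrix.of_apply, hu, Matrix.one_apply, eq_comm (a := k)]
      split_ifs <;> simp
    have h1 := Matrix.rank_mul_le_left (Matrix.of fun i s => eval 0 (A i s))
      (Matrix.of fun s k => eval 0 (B s k))
    rw [key, Matrix.rank_one, Fintype.card_fin] at h1
    exact absurd (h1.trans (Matrix.rank_le_card_width _)) (not_le.2 hcard)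

theorem isMinimallyGeneratedBy_octics (h2 : (2 : F) ≠ 0) (h7 : (7 : F) ≠ 0) {c : F}
    (hc : c ^ 2 + c + 2 = 0) :
    IsMinimallyGeneratedBy (Ideal.span (Set.range ![octicF c, octicG c, octicH c]))
      ![octicF c, octicG c, octicH c] := by
  apply isMinimallyGeneratedBy_of_syzygies
  intro u hu i
  have hres := isMinimalGradedFreeResolution_octics h2 h7 hc
  obtain ⟨v, rfl⟩ := (hres.exact u).1 hu
  exact eval_zero_of_mem_irrelevantIdeal (hres.minimal_left v i)

end Resolution

/-! ### Vanishing along lines through the origin, and division on a projective line -/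

section Cone

variable {F : Type*} [Field F]

/-- Restriction of polynomials to the line through the origin spanned by `w`. -/
noncomputable def coneHom (w : Fin 3 → F) : MvPolynomial (Fin 3) F →ₐ[F] Polynomial F :=
  aeval fun i => Polynomial.C (w i) * Polynomial.X

@[simp] theorem coneHom_X (w : Fin 3 → F) (i : Fin 3) :
    coneHom w (X i) = Polynomial.C (w i) * Polynomial.X := by simp [coneHom]

@[simp] theorem coneHom_C (w : Fin 3 → F) (a : F) : coneHom w (C a) = Polynomial.C a := by
  simp [coneHom]

theorem aeval_mul_const_of_isHomogeneous {σ A : Type*} [CommRing A] [Algebra F A]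
    {p : MvPolynomial σ F} {d : ℕ} (hp : p.IsHomogeneous d) (f : σ → A) (r : A) :
    aeval (fun i => f i * r) p = aeval f p * r ^ d := by
  rw [aeval_def, aeval_def, eval₂_eq, eval₂_eq, Finset.sum_mul]
  refine Finset.sum_congr rfl fun m hm => ?_
  have hd : ∑ i ∈ m.support, m i = d := (hp.degree_eq_sum_deg_support hm).symm
  rw [mul_assoc, ← hd, ← Finset.prod_pow_eq_pow_sum, ← Finset.prod_mul_distrib]
  simp only [mul_pow]

theorem eval_smul_of_isHomogeneous {p : MvPolynomial (Fin 3) F} {d : ℕ} (hp : p.IsHomogeneous d)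
    (r : F) (w : Fin 3 → F) : eval (r • w) p = eval w p * r ^ d := by
  have h := aeval_mul_const_of_isHomogeneous hp w r
  rw [← coe_aeval_eq_eval, ← coe_aeval_eq_eval]
  simpa [Pi.smul_def, mul_comm] using h

theorem coneHom_eq_of_isHomogeneous {p : MvPolynomial (Fin 3) F} {d : ℕ} (hp : p.IsHomogeneous d)
    (w : Fin 3 → F) : coneHom w p = Polynomial.C (eval w p) * Polynomial.X ^ d := by
  rw [coneHom, aeval_mul_const_of_isHomogeneous hp]
  exact congrArg (· * _) (by simpa [Function.comp_def] using aeval_algebraMap_apply (Polynomial F) w p)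

/-- Modulo K each variable is wᵢq, so p is congruent to its restriction to the line spanned by w,
evaluated at q. -/
theorem mem_of_coneHom_eq_zero {w : Fin 3 → F} {K : Ideal (MvPolynomial (Fin 3) F)}
    {p q : MvPolynomial (Fin 3) F} (hp : coneHom w p = 0) (hK : ∀ i, X i - C (w i) * q ∈ K) :
    p ∈ K := by
  have h : (aeval fun i => C (w i) * q) = (Polynomial.aeval q).comp (coneHom w) := by
    ext1 i
    simp [MvPolynomial.algebraMap_eq]
  have := sub_aeval_mem hK p
  rwa [h, AlgHom.comp_apply, hp, map_zero, sub_zero] at this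

/-- A polynomial vanishing on finitely many points of a line `L = 0` is, modulo `L`, divisible by
the product of the corresponding linear forms. -/
theorem mem_span_pair_of_coneHom_eq_zero {u v ℓ : Fin 3 → F} {U V L : MvPolynomial (Fin 3) F}
    (hX : ∀ i, X i = C (u i) * U + C (v i) * V + C (ℓ i) * L)
    (hU : ∀ a b : F, coneHom (a • u + b • v) U = Polynomial.C a * Polynomial.X)
    (hV : ∀ a b : F, coneHom (a • u + b • v) V = Polynomial.C b * Polynomial.X)
    (hL : ∀ a b : F, coneHom (a • u + b • v) L = 0) {p : MvPolynomial (Fin 3) F} :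
    ∀ T : List (F × F), T.Pairwise (fun s t => t.1 * s.2 ≠ s.1 * t.2) → (∀ t ∈ T, t ≠ 0) →
      (∀ t ∈ T, coneHom (t.1 • u + t.2 • v) p = 0) →
      p ∈ Ideal.span {L, (T.map fun t => C t.2 * U - C t.1 * V).prod}
  | [], _, _, _ => by
    exact Ideal.mem_span_pair.2 ⟨0, p, by simp⟩
  | (a, b) :: T, hT, h0, hp => by
    rw [List.pairwise_cons] at hT
    obtain ⟨r, s, hrs⟩ := Ideal.mem_span_pair.1 (mem_span_pair_of_coneHom_eq_zero hX hU hV hL T hT.2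
      (fun t ht => h0 t (List.mem_cons_of_mem _ ht))
      (fun t ht => hp t (List.mem_cons_of_mem _ ht)))
    -- The new point differs from the earlier ones, so the product does not vanish there and the
    -- cofactor s must.
    have hm : coneHom (a • u + b • v) (T.map fun t => C t.2 * U - C t.1 * V).prod ≠ 0 := by
      rw [map_list_prod]
      apply List.prod_ne_zero
      simp only [List.map_map, List.mem_map, not_exists, not_and]
      intro t ht h
      simp only [Function.comp_apply, map_sub, map_mul, hU, hV, coneHom_C] at h
      apply hT.1 t ht
      have h' := congrArg (Polynomial.eval 1) h
      simp at h'
      linear_combination -h'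
    have hs : coneHom (a • u + b • v) s = 0 := by
      have h1 := hp (a, b) List.mem_cons_self
      rw [← hrs, map_add, map_mul, map_mul, hL, mul_zero, zero_add] at h1
      exact (mul_eq_zero.1 h1).resolve_right hm
    -- Modulo these two linear forms every coordinate is proportional to U if a ≠ 0, and to V if b ≠
    -- 0.
    have hs' : s ∈ Ideal.span {L, C b * U - C a * V} := by
      rcases eq_or_ne a 0 with ha | ha
      · have hb : b ≠ 0 := by
          rintro rfl
          exact h0 (a, 0) List.mem_cons_self (by simp [ha])
        have hbb : (C b * C b⁻¹ : MvPolynomial (Fin 3) F) = 1 := by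
          rw [← C_mul, mul_inv_cancel₀ hb, C_1]
        refine mem_of_coneHom_eq_zero hs (q := C b⁻¹ * V) fun i => Ideal.mem_span_pair.2
          ⟨C (ℓ i), C (u i) * C b⁻¹, ?_⟩
        simp only [Pi.add_apply, Pi.smul_apply, smul_eq_mul, C_add, C_mul]
        linear_combination (C (u i) * U + C (v i) * V) * hbb - hX i
      · have haa : (C a * C a⁻¹ : MvPolynomial (Fin 3) F) = 1 := by
          rw [← C_mul, mul_inv_cancel₀ ha, C_1]
        refine mem_of_coneHom_eq_zero hs (q := C a⁻¹ * U) fun i => Ideal.mem_span_pair.2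
          ⟨C (ℓ i), -C (v i) * C a⁻¹, ?_⟩
        simp only [Pi.add_apply, Pi.smul_apply, smul_eq_mul, C_add, C_mul]
        linear_combination (C (u i) * U + C (v i) * V) * haa - hX i
    obtain ⟨y, z, hyz⟩ := Ideal.mem_span_pair.1 hs'
    refine Ideal.mem_span_pair.2 ⟨r + y * (T.map fun t => C t.2 * U - C t.1 * V).prod, z, ?_⟩
    rw [List.map_cons, List.prod_cons]
    linear_combination hrs + (T.map fun t => C t.2 * U - C t.1 * V).prod * hyz

/-- The form `m` cutting out a given set of points on the line `X i = ℓ` divides, modulo the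
equation of the line, every polynomial vanishing on these points. -/
theorem exists_eq_add_of_coneHom_eq_zero {u v : Fin 3 → F} {U V ℓ : MvPolynomial (Fin 3) F}
    {i : Fin 3} (e : Fin 3 → F)
    (hX : ∀ j, X j = C (u j) * U + C (v j) * V + C (e j) * (X i - ℓ))
    (hU : ∀ a b : F, coneHom (a • u + b • v) U = Polynomial.C a * Polynomial.X)
    (hV : ∀ a b : F, coneHom (a • u + b • v) V = Polynomial.C b * Polynomial.X)
    (hL : ∀ a b : F, coneHom (a • u + b • v) (X i - ℓ) = 0) {p m : MvPolynomial (Fin 3) F}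
    (T : List (F × F)) (hT : T.Pairwise (fun s t => t.1 * s.2 ≠ s.1 * t.2))
    (h0 : ∀ t ∈ T, t ≠ 0) (hp : ∀ t ∈ T, coneHom (t.1 • u + t.2 • v) p = 0) {κ q : F} (hκ : κ ≠ 0)
    (hm : aeval (Function.update X i ℓ)
      (C κ * (T.map fun t => C t.2 * U - C t.1 * V).prod - C q * m) = 0) :
    ∃ a s, p = (X i - ℓ) * a + m * s := by
  obtain ⟨r, s, hrs⟩ := Ideal.mem_span_pair.1 (mem_span_pair_of_coneHom_eq_zero hX hU hV hL T hT h0 hp)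
  -- By `hm`, κ times the product of point equations and q·m agree after substituting ℓ for `X i`,
  -- hence modulo `X i - ℓ`; κ is then inverted.
  have h1 := sub_aeval_mem (K := Ideal.span {X i - ℓ}) (θ := Function.update X i ℓ) (fun j => by
    rcases eq_or_ne j i with rfl | hj
    · simp
    · simp [Function.update_of_ne hj])
    (C κ * (T.map fun t => C t.2 * U - C t.1 * V).prod - C q * m)
  rw [hm, sub_zero] at h1
  obtain ⟨t, ht⟩ := Ideal.mem_span_singleton'.1 h1
  have hk : (C κ⁻¹ * C κ : MvPolynomial (Fin 3) F) = 1 := by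
    rw [← C_mul, inv_mul_cancel₀ hκ, C_1]
  refine ⟨r + s * C κ⁻¹ * t, s * C κ⁻¹ * C q, ?_⟩
  linear_combination -hrs - s * C κ⁻¹ * ht -
    s * (T.map fun t => C t.2 * U - C t.1 * V).prod * hk

/-- The inductive step of the peeling: the quotient by a removed line still vanishes at the points
off that line. -/
theorem coneHom_eq_zero_of_eq_add {w : Fin 3 → F} {p L a m s : MvPolynomial (Fin 3) F}
    (h : p = L * a + m * s) (hp : coneHom w p = 0) (hm : coneHom w m = 0) (hL : coneHom w L ≠ 0) :
    coneHom w a = 0 := by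
  rw [h, map_add, map_mul, map_mul, hm, zero_mul, add_zero] at hp
  exact (mul_eq_zero.1 hp).resolve_left hL

theorem coneHom_X_ne_zero {w : Fin 3 → F} {i : Fin 3} (hw : w i ≠ 0) : coneHom w (X i) ≠ 0 := by
  simp [hw]

theorem coneHom_X_sub_ne_zero {w : Fin 3 → F} {i j : Fin 3} {ε : F} (hw : w i ≠ ε * w j) :
    coneHom w (X i - C ε * X j) ≠ 0 := by
  have : coneHom w (X i - C ε * X j) = Polynomial.C (w i - ε * w j) * Polynomial.X := by
    simp; ring
  rw [this]
  exact mul_ne_zero (Polynomial.C_ne_zero.2 (sub_ne_zero.2 hw)) Polynomial.X_ne_zero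

end Cone

/-! ### The points of the configuration and the vanishing of the octics -/

section Points

variable {F : Type*} [Field F]

/-- The coordinate vectors of the points of the Klein configuration. -/
def IsKleinVector (c b : F) (w : Fin 3 → F) : Prop :=
  ∃ v ∈ baseVectors c b, ∃ σ : Equiv.Perm (Fin 3), ∃ r : F, r ≠ 0 ∧ w = r • (v ∘ σ)

theorem IsKleinVector.comp {c b : F} {w : Fin 3 → F} (hw : IsKleinVector c b w)
    (τ : Equiv.Perm (Fin 3)) : IsKleinVector c b (w ∘ τ) := by
  obtain ⟨v, hv, σ, r, hr, rfl⟩ := hw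
  exact ⟨v, hv, τ.trans σ, r, hr, rfl⟩

theorem baseVectors_ne_zero {c b : F} {v : Fin 3 → F} (hv : v ∈ baseVectors c b) : v ≠ 0 := by
  obtain ⟨s, t, hs, ht, h⟩ := hv
  have hs0 : s ≠ 0 := by rcases hs with rfl | rfl <;> simp
  intro h0
  rcases h with rfl | rfl | rfl | rfl | rfl | rfl
  · simpa using congrFun h0 0
  · simpa using congrFun h0 0
  · simpa using congrFun h0 0
  · simpa [hs0] using congrFun h0 1
  · simpa using congrFun h0 0
  · simpa [hs0] using congrFun h0 1

theorem comp_perm_ne_zero {v : Fin 3 → F} (hv : v ≠ 0) (σ : Equiv.Perm (Fin 3)) : v ∘ σ ≠ 0 := by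
  intro h
  apply hv
  ext i
  simpa using congrFun h (σ.symm i)

theorem IsKleinVector.ne_zero {c b : F} {w : Fin 3 → F} (hw : IsKleinVector c b w) : w ≠ 0 := by
  obtain ⟨v, hv, σ, r, hr, rfl⟩ := hw
  exact smul_ne_zero hr (comp_perm_ne_zero (baseVectors_ne_zero hv) σ)

theorem IsKleinVector.mk_mem {c b : F} {w : Fin 3 → F} (hw : IsKleinVector c b w) (h0 : w ≠ 0) :
    Projectivization.mk F w h0 ∈ kleinConfiguration c b := by
  obtain ⟨v, hv, σ, r, hr, rfl⟩ := hw
  refine ⟨v, hv, σ, comp_perm_ne_zero (baseVectors_ne_zero hv) σ, ?_⟩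
  rw [Projectivization.mk_eq_mk_iff']
  exact ⟨r, rfl⟩

theorem isKleinVector_rep {c b : F} {P : Projectivization F (Fin 3 → F)}
    (hP : P ∈ kleinConfiguration c b) : IsKleinVector c b P.rep := by
  obtain ⟨v, hv, σ, h0, rfl⟩ := hP
  obtain ⟨a, ha⟩ := Projectivization.exists_smul_eq_mk_rep F (v ∘ σ) h0
  exact ⟨v, hv, σ, a, a.ne_zero, ha.symm⟩

/-- Each `coneHom w` kills the generating forms and is a ring homomorphism, so p need not be
homogeneous. This formal vanishing replaces a decomposition into forms and is valid over small
finite fields too. -/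
theorem coneHom_eq_zero_of_mem_definingIdeal {c b : F} {p : MvPolynomial (Fin 3) F}
    (hp : p ∈ definingIdeal (kleinConfiguration c b)) {w : Fin 3 → F}
    (hw : IsKleinVector c b w) : coneHom w p = 0 := by
  suffices h : definingIdeal (kleinConfiguration c b) ≤ RingHom.ker (coneHom w) from h hp
  rw [definingIdeal, Ideal.span_le]
  rintro q ⟨⟨d, hd⟩, hq⟩
  have h1 := hq _ (hw.mk_mem hw.ne_zero)
  obtain ⟨a, ha⟩ := Projectivization.exists_smul_eq_mk_rep F w hw.ne_zero
  rw [← ha, Units.smul_def, eval_smul_of_isHomogeneous hd] at h1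
  have h2 := (mul_eq_zero.1 h1).resolve_right (pow_ne_zero d a.ne_zero)
  simp [coneHom_eq_of_isHomogeneous hd, h2]

theorem eval_octics_of_baseVectors {c b : F} (hs : c + b = -1) (hp : c * b = 2) {v : Fin 3 → F}
    (hv : v ∈ baseVectors c b) :
    eval v (octicF c) = 0 ∧ eval v (octicG c) = 0 ∧ eval v (octicH c) = 0 := by
  obtain ⟨s, t, h, h', hv⟩ := hv
  obtain rfl : b = -1 - c := by linear_combination hs
  have hc : c ^ 2 + c + 2 = 0 := by linear_combination -hp
  have e1 : s ^ 2 = 1 := by rcases h with rfl | rfl <;> simp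
  have e2 : t ^ 2 = 1 := by rcases h' with rfl | rfl <;> simp
  clear h h' hs hp
  rcases hv with rfl | rfl | rfl | rfl | rfl | rfl <;>
    simp only [octicF, octicG, octicH, map_add, map_sub, map_mul, map_pow, eval_X, eval_C,
      map_ofNat, map_one, Matrix.cons_val] <;> refine ⟨?_, ?_, ?_⟩ <;> grind

/-- Each transposition of coordinates permutes f, g, h up to sign. -/
theorem eval_octics_comp {c : F} {v : Fin 3 → F}
    (h : eval v (octicF c) = 0 ∧ eval v (octicG c) = 0 ∧ eval v (octicH c) = 0)
    (σ : Equiv.Perm (Fin 3)) : eval (v ∘ σ) (octicF c) = 0 ∧ eval (v ∘ σ) (octicG c) = 0 ∧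
      eval (v ∘ σ) (octicH c) = 0 := by
  induction σ using Equiv.Perm.swap_induction_on generalizing v with
  | one => exact h
  | swap_mul σ i j hij ih =>
    rw [Equiv.Perm.coe_mul, ← Function.comp_assoc]
    apply ih
    obtain ⟨hf, hg, hh⟩ := h
    simp only [octicF, octicG, octicH, map_add, map_sub, map_mul, map_pow, eval_X, eval_C,
      map_ofNat, map_one] at hf hg hh ⊢
    fin_cases i <;> fin_cases j <;>
      simp only [Fin.zero_eta, Fin.mk_one, Fin.reduceFinMk, Function.comp_apply,
        Equiv.swap_apply_def, Fin.reduceEq, if_true, if_false, ne_eq, not_true_eq_false] at hij ⊢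
    · exact ⟨by linear_combination -hf, by linear_combination -hh, by linear_combination -hg⟩
    · exact ⟨by linear_combination -hg, by linear_combination -hf, by linear_combination -hh⟩
    · exact ⟨by linear_combination -hf, by linear_combination -hh, by linear_combination -hg⟩
    · exact ⟨by linear_combination -hh, by linear_combination -hg, by linear_combination -hf⟩
    · exact ⟨by linear_combination -hg, by linear_combination -hf, by linear_combination -hh⟩
    · exact ⟨by linear_combination -hh, by linear_combination -hg, by linear_combination -hf⟩

theorem eval_octics_of_isKleinVector {c b : F} (hs : c + b = -1) (hp : c * b = 2) {w : Fin 3 → F}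
    (hw : IsKleinVector c b w) :
    eval w (octicF c) = 0 ∧ eval w (octicG c) = 0 ∧ eval w (octicH c) = 0 := by
  obtain ⟨v, hv, σ, r, hr, rfl⟩ := hw
  obtain ⟨hf, hg, hh⟩ := eval_octics_comp (eval_octics_of_baseVectors hs hp hv) σ
  rw [eval_smul_of_isHomogeneous (isHomogeneous_octicF c),
    eval_smul_of_isHomogeneous (isHomogeneous_octicG c),
    eval_smul_of_isHomogeneous (isHomogeneous_octicH c), hf, hg, hh]
  simp

theorem coneHom_octics {c b : F} (hs : c + b = -1) (hp : c * b = 2) {w : Fin 3 → F}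
    (hw : IsKleinVector c b w) :
    coneHom w (octicF c) = 0 ∧ coneHom w (octicG c) = 0 ∧ coneHom w (octicH c) = 0 := by
  obtain ⟨hf, hg, hh⟩ := eval_octics_of_isKleinVector hs hp hw
  rw [coneHom_eq_of_isHomogeneous (isHomogeneous_octicF c),
    coneHom_eq_of_isHomogeneous (isHomogeneous_octicG c),
    coneHom_eq_of_isHomogeneous (isHomogeneous_octicH c), hf, hg, hh]
  simp

theorem span_octics_le_definingIdeal {c b : F} (hs : c + b = -1) (hp : c * b = 2) :
    Ideal.span (Set.range ![octicF c, octicG c, octicH c]) ≤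
      definingIdeal (kleinConfiguration c b) := by
  rw [Ideal.span_le]
  rintro _ ⟨i, rfl⟩
  apply Ideal.subset_span
  have h := fun P (hP : P ∈ kleinConfiguration c b) =>
    eval_octics_of_isKleinVector hs hp (isKleinVector_rep hP)
  fin_cases i
  · exact ⟨⟨8, isHomogeneous_octicF c⟩, fun P hP => (h P hP).1⟩
  · exact ⟨⟨8, isHomogeneous_octicG c⟩, fun P hP => (h P hP).2.1⟩
  · exact ⟨⟨8, isHomogeneous_octicH c⟩, fun P hP => (h P hP).2.2⟩

end Points

/-! ### Equations of the remaining points on each of the nine lines -/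

section Peeling

variable {F : Type*} [Field F]

theorem exists_eq_add_z {p m : MvPolynomial (Fin 3) F}
    (T : List (F × F)) (hT : T.Pairwise (fun s t => t.1 * s.2 ≠ s.1 * t.2))
    (h0 : ∀ t ∈ T, t ≠ 0) (hp : ∀ t ∈ T, coneHom ![t.1, t.2, 0] p = 0) {κ q : F} (hκ : κ ≠ 0)
    (hm : aeval (Function.update X 2 0)
      (C κ * (T.map fun t => C t.2 * X 0 - C t.1 * X 1).prod - C q * m) = (0 : MvPolynomial (Fin 3) F)) :
    ∃ a s, p = X 2 * a + m * s := by
  have h := exists_eq_add_of_coneHom_eq_zero (u := ![1, 0, 0]) (v := ![0, 1, 0]) (U := X 0)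
    (V := X 1) (ℓ := 0) (i := 2) (p := p) (m := m) ![0, 0, 1] (by simp [Fin.forall_fin_succ])
    (by simp) (by simp) (by simp) T hT h0 (by simpa using hp) hκ hm
  simpa using h

theorem exists_eq_add_y {p m : MvPolynomial (Fin 3) F}
    (T : List (F × F)) (hT : T.Pairwise (fun s t => t.1 * s.2 ≠ s.1 * t.2))
    (h0 : ∀ t ∈ T, t ≠ 0) (hp : ∀ t ∈ T, coneHom ![t.1, 0, t.2] p = 0) {κ q : F} (hκ : κ ≠ 0)
    (hm : aeval (Function.update X 1 0)
      (C κ * (T.map fun t => C t.2 * X 0 - C t.1 * X 2).prod - C q * m) = (0 : MvPolynomial (Fin 3) F)) :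
    ∃ a s, p = X 1 * a + m * s := by
  have h := exists_eq_add_of_coneHom_eq_zero (u := ![1, 0, 0]) (v := ![0, 0, 1]) (U := X 0)
    (V := X 2) (ℓ := 0) (i := 1) (p := p) (m := m) ![0, 1, 0] (by simp [Fin.forall_fin_succ])
    (by simp) (by simp) (by simp) T hT h0 (by simpa using hp) hκ hm
  simpa using h

theorem exists_eq_add_x {p m : MvPolynomial (Fin 3) F}
    (T : List (F × F)) (hT : T.Pairwise (fun s t => t.1 * s.2 ≠ s.1 * t.2))
    (h0 : ∀ t ∈ T, t ≠ 0) (hp : ∀ t ∈ T, coneHom ![0, t.1, t.2] p = 0) {κ q : F} (hκ : κ ≠ 0)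
    (hm : aeval (Function.update X 0 0)
      (C κ * (T.map fun t => C t.2 * X 1 - C t.1 * X 2).prod - C q * m) = (0 : MvPolynomial (Fin 3) F)) :
    ∃ a s, p = X 0 * a + m * s := by
  have h := exists_eq_add_of_coneHom_eq_zero (u := ![0, 1, 0]) (v := ![0, 0, 1]) (U := X 1)
    (V := X 2) (ℓ := 0) (i := 0) (p := p) (m := m) ![1, 0, 0] (by simp [Fin.forall_fin_succ])
    (by simp) (by simp) (by simp) T hT h0 (by simpa using hp) hκ hm
  simpa using h

theorem exists_eq_add_yz (ε : F) {p m : MvPolynomial (Fin 3) F}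
    (T : List (F × F)) (hT : T.Pairwise (fun s t => t.1 * s.2 ≠ s.1 * t.2))
    (h0 : ∀ t ∈ T, t ≠ 0) (hp : ∀ t ∈ T, coneHom ![t.1, t.2 * ε, t.2] p = 0) {κ q : F} (hκ : κ ≠ 0)
    (hm : aeval (Function.update X 1 (C ε * X 2))
      (C κ * (T.map fun t => C t.2 * X 0 - C t.1 * X 2).prod - C q * m) = 0) :
    ∃ a s, p = (X 1 - C ε * X 2) * a + m * s :=
  exists_eq_add_of_coneHom_eq_zero (u := ![1, 0, 0]) (v := ![0, ε, 1]) (U := X 0)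
    (V := X 2) (ℓ := C ε * X 2) (i := 1) (p := p) (m := m) ![0, 1, 0]
    (by simp [Fin.forall_fin_succ]) (by simp) (by simp) (by intro a b; simp; ring)
    T hT h0 (by simpa using hp) hκ hm

theorem exists_eq_add_xy (ε : F) {p m : MvPolynomial (Fin 3) F}
    (T : List (F × F)) (hT : T.Pairwise (fun s t => t.1 * s.2 ≠ s.1 * t.2))
    (h0 : ∀ t ∈ T, t ≠ 0) (hp : ∀ t ∈ T, coneHom ![t.1 * ε, t.1, t.2] p = 0) {κ q : F} (hκ : κ ≠ 0)
    (hm : aeval (Function.update X 0 (C ε * X 1))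
      (C κ * (T.map fun t => C t.2 * X 1 - C t.1 * X 2).prod - C q * m) = 0) :
    ∃ a s, p = (X 0 - C ε * X 1) * a + m * s :=
  exists_eq_add_of_coneHom_eq_zero (u := ![ε, 1, 0]) (v := ![0, 0, 1]) (U := X 1)
    (V := X 2) (ℓ := C ε * X 1) (i := 0) (p := p) (m := m) ![1, 0, 0]
    (by simp [Fin.forall_fin_succ]) (by simp) (by simp) (by intro a b; simp; ring)
    T hT h0 (by simpa using hp) hκ hm

theorem exists_eq_add_xz (ε : F) {p m : MvPolynomial (Fin 3) F}
    (T : List (F × F)) (hT : T.Pairwise (fun s t => t.1 * s.2 ≠ s.1 * t.2))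
    (h0 : ∀ t ∈ T, t ≠ 0) (hp : ∀ t ∈ T, coneHom ![t.2 * ε, t.1, t.2] p = 0) {κ q : F} (hκ : κ ≠ 0)
    (hm : aeval (Function.update X 0 (C ε * X 2))
      (C κ * (T.map fun t => C t.2 * X 1 - C t.1 * X 2).prod - C q * m) = 0) :
    ∃ a s, p = (X 0 - C ε * X 2) * a + m * s :=
  exists_eq_add_of_coneHom_eq_zero (u := ![0, 1, 0]) (v := ![ε, 0, 1]) (U := X 1)
    (V := X 2) (ℓ := C ε * X 2) (i := 0) (p := p) (m := m) ![1, 0, 0]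
    (by simp [Fin.forall_fin_succ]) (by simp) (by simp) (by intro a b; simp; ring)
    T hT h0 (by simpa using hp) hκ hm

/-- The quartic cofactor of `octicF`. -/
noncomputable def factorF (c : F) : MvPolynomial (Fin 3) F :=
  4 * X 0 ^ 4 + 4 * X 1 ^ 4 + C (3 * c + 9) * X 0 ^ 2 * X 1 ^ 2 + C (5 * c - 1) * X 0 ^ 2 * X 2 ^ 2
    + C (5 * c - 1) * X 1 ^ 2 * X 2 ^ 2 + C (15 * c + 25) * X 2 ^ 4

/-- The quartic cofactor of `octicG`. -/
noncomputable def factorG (c : F) : MvPolynomial (Fin 3) F :=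
  C (15 * c + 25) * X 0 ^ 4 + 4 * X 1 ^ 4 + C (5 * c - 1) * X 0 ^ 2 * X 1 ^ 2
    + C (5 * c - 1) * X 0 ^ 2 * X 2 ^ 2 + C (3 * c + 9) * X 1 ^ 2 * X 2 ^ 2 + 4 * X 2 ^ 4

/-- The quartic cofactor of `octicH`. -/
noncomputable def factorH (c : F) : MvPolynomial (Fin 3) F :=
  4 * X 0 ^ 4 + C (15 * c + 25) * X 1 ^ 4 + C (5 * c - 1) * X 0 ^ 2 * X 1 ^ 2
    + C (3 * c + 9) * X 0 ^ 2 * X 2 ^ 2 + C (5 * c - 1) * X 1 ^ 2 * X 2 ^ 2 + 4 * X 2 ^ 4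

variable {c b : F}

/-- Every failure would make a power of 2 vanish; for instance c = 1 gives 4 = 0, and c² = -1 gives
c = -1 and then 2 = 0. -/
theorem coord_facts (h2 : (2 : F) ≠ 0) (hs : c + b = -1) (hp : c * b = 2) :
    (4 : F) ≠ 0 ∧ c ≠ 0 ∧ b ≠ 0 ∧ c ≠ 1 ∧ c ≠ -1 ∧ b ≠ 1 ∧ b ≠ -1 ∧ c ^ 2 ≠ 1 ∧ c ^ 2 ≠ -1 ∧
      b ^ 2 ≠ 1 ∧ b ^ 2 ≠ -1 := by
  have h4 : (4 : F) ≠ 0 := by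
    have : (4 : F) = 2 * 2 := by norm_num
    rw [this]; exact mul_ne_zero h2 h2
  obtain rfl : b = -1 - c := by linear_combination hs
  have hc1 : c ≠ 1 := by intro h; grind
  have hc1' : c ≠ -1 := by intro h; grind
  have hb1 : -1 - c ≠ 1 := by intro h; grind
  have hb1' : -1 - c ≠ -1 := by intro h; grind
  refine ⟨h4, ?_, ?_, hc1, hc1', hb1, hb1', by simp [hc1, hc1'], ?_,
    by simp [hb1, hb1'], ?_⟩ <;> intro h <;> grind

theorem C_root (hc : c ^ 2 + c + 2 = 0) : (C c ^ 2 + C c + 2 : MvPolynomial (Fin 3) F) = 0 := by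
  rw [← map_ofNat C, ← map_pow, ← map_add, ← map_add, hc, map_zero]

/-- On z = 0 the octic f is, up to a unit, the product of the equations of the eight points there.
The 4 matches its leading coefficient, and -c² comes from the scaling of the linear factors. The
next lemmas do the same for the points left on the other lines, with an octic stripped of removed
lines. -/
theorem aeval_line_z (hs : c + b = -1) (hp : c * b = 2) :
    aeval (Function.update X 2 0) (C 4 * (([(1, 0), (0, 1), (1, 1), (1, -1), (c, 1), (c, -1), (1, c), (-1, c)] : List (F × F)).map
      fun t => C t.2 * X 0 - C t.1 * X 1).prod - C (-c ^ 2) * octicF c) =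
      (0 : MvPolynomial (Fin 3) F) := by
  obtain rfl : b = -1 - c := by linear_combination hs
  have hc : (C c ^ 2 + C c + 2 : MvPolynomial (Fin 3) F) = 0 := C_root (by linear_combination -hp)
  simp only [List.map_cons, List.map_nil, List.prod_cons, List.prod_nil, octicF,
    map_add, map_sub, map_mul, map_pow, aeval_X, algHom_C, algebraMap_eq, map_ofNat,
    map_one, map_neg, map_zero, Function.update_apply, Fin.reduceEq, if_true, if_false]
  clear hs hp
  grind

theorem aeval_line_y (hs : c + b = -1) (hp : c * b = 2) :
    aeval (Function.update X 1 0) (C 4 * (([(0, 1), (1, 1), (1, -1), (c, 1), (c, -1), (1, c), (-1, c)] : List (F × F)).map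
      fun t => C t.2 * X 0 - C t.1 * X 2).prod - C (-c ^ 2) * (X 0 * (X 2 ^ 2 - X 0 ^ 2) * factorH c)) =
      (0 : MvPolynomial (Fin 3) F) := by
  obtain rfl : b = -1 - c := by linear_combination hs
  have hc : (C c ^ 2 + C c + 2 : MvPolynomial (Fin 3) F) = 0 := C_root (by linear_combination -hp)
  simp only [List.map_cons, List.map_nil, List.prod_cons, List.prod_nil, factorH,
    map_add, map_sub, map_mul, map_pow, aeval_X, algHom_C, algebraMap_eq, map_ofNat,
    map_one, map_neg, map_zero, Function.update_apply, Fin.reduceEq, if_true, if_false]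
  clear hs hp
  grind

theorem aeval_line_x (hs : c + b = -1) (hp : c * b = 2) :
    aeval (Function.update X 0 0) (C 4 * (([(1, 1), (1, -1), (c, 1), (c, -1), (1, c), (-1, c)] : List (F × F)).map
      fun t => C t.2 * X 1 - C t.1 * X 2).prod - C (c ^ 2) * ((X 1 ^ 2 - X 2 ^ 2) * factorG c)) =
      (0 : MvPolynomial (Fin 3) F) := by
  obtain rfl : b = -1 - c := by linear_combination hs
  have hc : (C c ^ 2 + C c + 2 : MvPolynomial (Fin 3) F) = 0 := C_root (by linear_combination -hp)
  simp only [List.map_cons, List.map_nil, List.prod_cons, List.prod_nil, factorG,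
    map_add, map_sub, map_mul, map_pow, aeval_X, algHom_C, algebraMap_eq, map_ofNat,
    map_one, map_neg, Function.update_apply, Fin.reduceEq, if_true, if_false]
  clear hs hp
  grind

theorem aeval_line_yz {ε : F} (hε : ε ^ 2 = 1) (hs : c + b = -1) (hp : c * b = 2) :
    aeval (Function.update X 1 (C ε * X 2)) (C 4 * (([(1, 1), (-1, 1), (b, 1), (-b, 1), (b ^ 2, 1), (-b ^ 2, 1)] : List (F × F)).map
      fun t => C t.2 * X 0 - C t.1 * X 2).prod - C (1) * ((X 0 ^ 2 - X 1 ^ 2) * factorF c)) =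
      (0 : MvPolynomial (Fin 3) F) := by
  obtain rfl : b = -1 - c := by linear_combination hs
  have hc : (C c ^ 2 + C c + 2 : MvPolynomial (Fin 3) F) = 0 := C_root (by linear_combination -hp)
  have hεC : (C ε ^ 2 : MvPolynomial (Fin 3) F) = 1 := by rw [← map_pow, hε, map_one]
  simp only [List.map_cons, List.map_nil, List.prod_cons, List.prod_nil, factorF,
    map_add, map_sub, map_mul, map_pow, aeval_X, algHom_C, algebraMap_eq, map_ofNat,
    map_one, map_neg, Function.update_apply, Fin.reduceEq, if_true, if_false]
  clear hs hp hε
  grind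

theorem aeval_line_xy {ε : F} (hε : ε ^ 2 = 1) (hs : c + b = -1) (hp : c * b = 2) :
    aeval (Function.update X 0 (C ε * X 1)) (C 4 * (([(1, b), (1, -b), (1, b ^ 2), (1, -b ^ 2)] : List (F × F)).map
      fun t => C t.2 * X 1 - C t.1 * X 2).prod - C (1) * factorG c) =
      (0 : MvPolynomial (Fin 3) F) := by
  obtain rfl : b = -1 - c := by linear_combination hs
  have hc : (C c ^ 2 + C c + 2 : MvPolynomial (Fin 3) F) = 0 := C_root (by linear_combination -hp)
  have hεC : (C ε ^ 2 : MvPolynomial (Fin 3) F) = 1 := by rw [← map_pow, hε, map_one]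
  simp only [List.map_cons, List.map_nil, List.prod_cons, List.prod_nil, factorG,
    map_add, map_sub, map_mul, map_pow, aeval_X, algHom_C, algebraMap_eq, map_ofNat,
    map_one, map_neg, Function.update_apply, Fin.reduceEq, if_true, if_false]
  clear hs hp hε
  grind

theorem aeval_line_xz {ε : F} (hε : ε ^ 2 = 1) (hs : c + b = -1) (hp : c * b = 2) :
    aeval (Function.update X 0 (C ε * X 2)) (C 4 * (([(b, 1), (-b, 1), (b ^ 2, 1), (-b ^ 2, 1)] : List (F × F)).map
      fun t => C t.2 * X 1 - C t.1 * X 2).prod - C (1) * factorG c) =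
      (0 : MvPolynomial (Fin 3) F) := by
  obtain rfl : b = -1 - c := by linear_combination hs
  have hc : (C c ^ 2 + C c + 2 : MvPolynomial (Fin 3) F) = 0 := C_root (by linear_combination -hp)
  have hεC : (C ε ^ 2 : MvPolynomial (Fin 3) F) = 1 := by rw [← map_pow, hε, map_one]
  simp only [List.map_cons, List.map_nil, List.prod_cons, List.prod_nil, factorG,
    map_add, map_sub, map_mul, map_pow, aeval_X, algHom_C, algebraMap_eq, map_ofNat,
    map_one, map_neg, Function.update_apply, Fin.reduceEq, if_true, if_false]
  clear hs hp hε
  grind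

theorem pairwise_line_z (h2 : (2 : F) ≠ 0) (hs : c + b = -1) (hp : c * b = 2) :
    ([(1, 0), (0, 1), (1, 1), (1, -1), (c, 1), (c, -1), (1, c), (-1, c)] : List (F × F)).Pairwise
      (fun s t => t.1 * s.2 ≠ s.1 * t.2) := by
  obtain ⟨h4, hc0, hb0, hc1, hc1', hb1, hb1', hc2, hc2', hb2, hb2'⟩ := coord_facts h2 hs hp
  clear hs hp
  simp only [List.pairwise_cons, List.forall_mem_cons, ne_eq]
  and_intros <;> first | simp; done | (intro h; grind)

theorem pairwise_line_yz (h2 : (2 : F) ≠ 0) (hs : c + b = -1) (hp : c * b = 2) :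
    ([(1, 1), (-1, 1), (b, 1), (-b, 1), (b ^ 2, 1), (-b ^ 2, 1)] : List (F × F)).Pairwise
      (fun s t => t.1 * s.2 ≠ s.1 * t.2) := by
  obtain ⟨h4, hc0, hb0, hc1, hc1', hb1, hb1', hc2, hc2', hb2, hb2'⟩ := coord_facts h2 hs hp
  clear hs hp
  simp only [List.pairwise_cons, List.forall_mem_cons, ne_eq]
  and_intros <;> first | simp; done | (intro h; grind)

theorem pairwise_line_xy (h2 : (2 : F) ≠ 0) (hs : c + b = -1) (hp : c * b = 2) :
    ([(1, b), (1, -b), (1, b ^ 2), (1, -b ^ 2)] : List (F × F)).Pairwise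
      (fun s t => t.1 * s.2 ≠ s.1 * t.2) := by
  obtain ⟨h4, hc0, hb0, hc1, hc1', hb1, hb1', hc2, hc2', hb2, hb2'⟩ := coord_facts h2 hs hp
  clear hs hp
  simp only [List.pairwise_cons, List.forall_mem_cons, ne_eq]
  and_intros <;> first | simp; done | (intro h; grind)

theorem pairwise_line_xz (h2 : (2 : F) ≠ 0) (hs : c + b = -1) (hp : c * b = 2) :
    ([(b, 1), (-b, 1), (b ^ 2, 1), (-b ^ 2, 1)] : List (F × F)).Pairwise
      (fun s t => t.1 * s.2 ≠ s.1 * t.2) := by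
  obtain ⟨h4, hc0, hb0, hc1, hc1', hb1, hb1', hc2, hc2', hb2, hb2'⟩ := coord_facts h2 hs hp
  clear hs hp
  simp only [List.pairwise_cons, List.forall_mem_cons, ne_eq]
  and_intros <;> first | simp; done | (intro h; grind)

end Peeling

/-! ### The octics generate the defining ideal -/

section Ideal

variable {F : Type*} [Field F] {c b : F}

theorem isKleinVector_of_mem {v : Fin 3 → F} (hv : v ∈ baseVectors c b) : IsKleinVector c b v :=
  ⟨v, hv, 1, 1, one_ne_zero, by simp⟩

theorem IsKleinVector.smul {w : Fin 3 → F} (hw : IsKleinVector c b w) {r : F} (hr : r ≠ 0) :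
    IsKleinVector c b (r • w) := by
  obtain ⟨v, hv, σ, s, hs, rfl⟩ := hw
  exact ⟨v, hv, σ, r * s, mul_ne_zero hr hs, by rw [smul_smul]⟩

theorem IsKleinVector.swap₀₁ {x y z : F} (h : IsKleinVector c b ![x, y, z]) :
    IsKleinVector c b ![y, x, z] := by
  convert! h.comp (Equiv.swap 0 1) using 1
  ext i; fin_cases i <;> rfl

theorem IsKleinVector.swap₁₂ {x y z : F} (h : IsKleinVector c b ![x, y, z]) :
    IsKleinVector c b ![x, z, y] := by
  convert! h.comp (Equiv.swap 1 2) using 1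
  ext i; fin_cases i <;> rfl

theorem isKleinVector_single : IsKleinVector c b ![1, 0, 0] :=
  isKleinVector_of_mem ⟨1, 1, .inl rfl, .inl rfl, .inl rfl⟩

theorem isKleinVector_one_zero {s : F} (hs : s = 1 ∨ s = -1) : IsKleinVector c b ![1, s, 0] :=
  isKleinVector_of_mem ⟨s, 1, hs, .inl rfl, .inr (.inl rfl)⟩

theorem isKleinVector_c_zero {s : F} (hs : s = 1 ∨ s = -1) : IsKleinVector c b ![c, s, 0] :=
  isKleinVector_of_mem ⟨s, 1, hs, .inl rfl, .inr (.inr (.inr (.inl rfl)))⟩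

theorem isKleinVector_one {s t : F} (hs : s = 1 ∨ s = -1) (ht : t = 1 ∨ t = -1) :
    IsKleinVector c b ![1, s, t] :=
  isKleinVector_of_mem ⟨s, t, hs, ht, .inr (.inr (.inr (.inr (.inl rfl))))⟩

theorem isKleinVector_b {s : F} (hs : s = 1 ∨ s = -1) : IsKleinVector c b ![1, s, b] :=
  isKleinVector_of_mem ⟨s, 1, hs, .inl rfl, .inr (.inr (.inl (by simp)))⟩

theorem isKleinVector_neg_b {s : F} (hs : s = 1 ∨ s = -1) : IsKleinVector c b ![1, s, -b] :=
  isKleinVector_of_mem ⟨s, -1, hs, .inr rfl, .inr (.inr (.inl (by simp)))⟩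

theorem isKleinVector_b_sq {s t : F} (hs : s = 1 ∨ s = -1) (ht : t = 1 ∨ t = -1) :
    IsKleinVector c b ![b ^ 2, s, t] :=
  isKleinVector_of_mem ⟨s, t, hs, ht, .inr (.inr (.inr (.inr (.inr rfl))))⟩

theorem isKleinVector_neg_b_sq {s t : F} (hs : s = 1 ∨ s = -1) (ht : t = 1 ∨ t = -1) :
    IsKleinVector c b ![-b ^ 2, s, t] := by
  have h := (isKleinVector_b_sq (c := c) (b := b) (s := -s) (t := -t)
    (by rcases hs with rfl | rfl <;> simp) (by rcases ht with rfl | rfl <;> simp)).smul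
    (neg_ne_zero.2 one_ne_zero)
  simpa using h

theorem octics_factor (c : F) : octicF c = X 0 * X 1 * (X 0 ^ 2 - X 1 ^ 2) * factorF c ∧
    octicG c = X 1 * X 2 * (X 1 ^ 2 - X 2 ^ 2) * factorG c ∧
    octicH c = X 2 * X 0 * (X 2 ^ 2 - X 0 ^ 2) * factorH c := ⟨rfl, rfl, rfl⟩

theorem mem_span_octics (h2 : (2 : F) ≠ 0) (h7 : (7 : F) ≠ 0) (hs : c + b = -1) (hp : c * b = 2)
    {p : MvPolynomial (Fin 3) F} (hpK : ∀ w, IsKleinVector c b w → coneHom w p = 0) :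
    p ∈ Ideal.span (Set.range ![octicF c, octicG c, octicH c]) := by
  have hc : c ^ 2 + c + 2 = 0 := by
    obtain rfl : b = -1 - c := by linear_combination hs
    linear_combination -hp
  obtain ⟨h4, hc0, hb0, hc1, hc1', hb1, hb1', hc2, hc2', hb2, hb2'⟩ := coord_facts h2 hs hp
  have h11 : (1 : F) ≠ -1 := by intro h; apply h2; linear_combination h
  have i1 : (1 : F) = 1 ∨ (1 : F) = -1 := .inl rfl
  have i2 : (-1 : F) = 1 ∨ (-1 : F) = -1 := .inr rfl
  have q1 : (1 : F) ^ 2 = 1 := one_pow 2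
  have q2 : (-1 : F) ^ 2 = 1 := by norm_num
  -- the coordinate lines
  obtain ⟨a₁, s₁, e₁⟩ := exists_eq_add_z (p := p) (m := octicF c) _ (pairwise_line_z h2 hs hp)
    (by simp)
    (by
      simp only [List.forall_mem_cons]
      exact ⟨hpK _ isKleinVector_single, hpK _ isKleinVector_single.swap₀₁,
        hpK _ (isKleinVector_one_zero i1), hpK _ (isKleinVector_one_zero i2),
        hpK _ (isKleinVector_c_zero i1), hpK _ (isKleinVector_c_zero i2),
        hpK _ (isKleinVector_c_zero i1).swap₀₁, hpK _ (isKleinVector_c_zero i2).swap₀₁, by simp⟩)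
    h4 (aeval_line_z hs hp)
  have h₁ : ∀ w, IsKleinVector c b w → w 2 ≠ 0 → coneHom w a₁ = 0 := fun w hw hw2 =>
    coneHom_eq_zero_of_eq_add e₁ (hpK w hw) (coneHom_octics hs hp hw).1 (coneHom_X_ne_zero hw2)
  -- The form is h/z. The point (1:0:0) was removed with z = 0, so the first entry of the list is
  -- dropped; on x = 0 both (0:1:0) and (0:0:1) are gone.
  obtain ⟨a₂, s₂, e₂⟩ := exists_eq_add_y (p := a₁) (m := X 0 * (X 2 ^ 2 - X 0 ^ 2) * factorH c) _
    (pairwise_line_z h2 hs hp).tail (by simp)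
    (by
      simp only [List.tail_cons, List.forall_mem_cons]
      exact ⟨h₁ _ isKleinVector_single.swap₀₁.swap₁₂ (by simp),
        h₁ _ (isKleinVector_one_zero i1).swap₁₂ (by simp),
        h₁ _ (isKleinVector_one_zero i2).swap₁₂ (by simp),
        h₁ _ (isKleinVector_c_zero i1).swap₁₂ (by simp),
        h₁ _ (isKleinVector_c_zero i2).swap₁₂ (by simp),
        h₁ _ (isKleinVector_c_zero i1).swap₀₁.swap₁₂ (by simpa using hc0),
        h₁ _ (isKleinVector_c_zero i2).swap₀₁.swap₁₂ (by simpa using hc0), by simp⟩)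
    h4 (aeval_line_y hs hp)
  have h₂ : ∀ w, IsKleinVector c b w → w 1 ≠ 0 → w 2 ≠ 0 → coneHom w a₂ = 0 := by
    intro w hw hw1 hw2
    refine coneHom_eq_zero_of_eq_add e₂ (h₁ w hw hw2) ?_ (coneHom_X_ne_zero hw1)
    have h := (coneHom_octics hs hp hw).2.2
    rw [(octics_factor c).2.2, mul_assoc (X 2), mul_assoc (X 2), map_mul] at h
    exact (mul_eq_zero.1 h).resolve_left (coneHom_X_ne_zero hw2)
  obtain ⟨a₃, s₃, e₃⟩ := exists_eq_add_x (p := a₂) (m := (X 1 ^ 2 - X 2 ^ 2) * factorG c) _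
    (pairwise_line_z h2 hs hp).tail.tail (by simp)
    (by
      simp only [List.tail_cons, List.forall_mem_cons]
      exact ⟨h₂ _ (isKleinVector_one_zero i1).swap₁₂.swap₀₁ (by simp) (by simp),
        h₂ _ (isKleinVector_one_zero i2).swap₁₂.swap₀₁ (by simp) (by simp),
        h₂ _ (isKleinVector_c_zero i1).swap₁₂.swap₀₁ (by simpa using hc0) (by simp),
        h₂ _ (isKleinVector_c_zero i2).swap₁₂.swap₀₁ (by simpa using hc0) (by simp),
        h₂ _ (isKleinVector_c_zero i1).swap₀₁.swap₁₂.swap₀₁ (by simp) (by simpa using hc0),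
        h₂ _ (isKleinVector_c_zero i2).swap₀₁.swap₁₂.swap₀₁ (by simp) (by simpa using hc0),
        by simp⟩)
    h4 (aeval_line_x hs hp)
  have hG : ∀ w, IsKleinVector c b w → w 1 ≠ 0 → w 2 ≠ 0 →
      coneHom w ((X 1 ^ 2 - X 2 ^ 2) * factorG c) = 0 := by
    intro w hw hw1 hw2
    have h := (coneHom_octics hs hp hw).2.1
    rw [(octics_factor c).2.1, mul_assoc (X 1 * X 2), map_mul, map_mul] at h
    exact (mul_eq_zero.1 h).resolve_left
      (mul_ne_zero (coneHom_X_ne_zero hw1) (coneHom_X_ne_zero hw2))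
  have hF : ∀ w, IsKleinVector c b w → w 0 ≠ 0 → w 1 ≠ 0 →
      coneHom w ((X 0 ^ 2 - X 1 ^ 2) * factorF c) = 0 := by
    intro w hw hw1 hw2
    have h := (coneHom_octics hs hp hw).1
    rw [(octics_factor c).1, mul_assoc (X 0 * X 1), map_mul, map_mul] at h
    exact (mul_eq_zero.1 h).resolve_left
      (mul_ne_zero (coneHom_X_ne_zero hw1) (coneHom_X_ne_zero hw2))
  have h₃ : ∀ w, IsKleinVector c b w → w 0 ≠ 0 → w 1 ≠ 0 → w 2 ≠ 0 → coneHom w a₃ = 0 :=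
    fun w hw hw0 hw1 hw2 => coneHom_eq_zero_of_eq_add e₃ (h₂ w hw hw1 hw2) (hG w hw hw1 hw2)
      (coneHom_X_ne_zero hw0)
  -- the lines `y = ± z`
  obtain ⟨a₄, s₄, e₄⟩ := exists_eq_add_yz 1 (p := a₃) (m := (X 0 ^ 2 - X 1 ^ 2) * factorF c) _
    (pairwise_line_yz h2 hs hp) (by simp)
    (by
      simp only [List.forall_mem_cons, one_mul]
      exact ⟨h₃ _ (isKleinVector_one i1 i1) (by simp) (by simp) (by simp),
        h₃ _ (isKleinVector_one i1 i2).swap₁₂.swap₀₁ (by simp) (by simp) (by simp),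
        h₃ _ (isKleinVector_b i1).swap₁₂.swap₀₁ (by simpa using hb0) (by simp) (by simp),
        h₃ _ (isKleinVector_neg_b i1).swap₁₂.swap₀₁ (by simpa using hb0) (by simp) (by simp),
        h₃ _ (isKleinVector_b_sq i1 i1) (by simpa using hb0) (by simp) (by simp),
        h₃ _ (isKleinVector_neg_b_sq i1 i1) (by simpa using hb0) (by simp) (by simp), by simp⟩)
    h4 (aeval_line_yz q1 hs hp)
  have h₄ : ∀ w, IsKleinVector c b w → w 0 ≠ 0 → w 1 ≠ 0 → w 2 ≠ 0 → w 1 ≠ 1 * w 2 →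
      coneHom w a₄ = 0 :=
    fun w hw hw0 hw1 hw2 hw12 => coneHom_eq_zero_of_eq_add e₄ (h₃ w hw hw0 hw1 hw2)
      (hF w hw hw0 hw1) (coneHom_X_sub_ne_zero hw12)
  obtain ⟨a₅, s₅, e₅⟩ := exists_eq_add_yz (-1) (p := a₄) (m := (X 0 ^ 2 - X 1 ^ 2) * factorF c) _
    (pairwise_line_yz h2 hs hp) (by simp)
    (by
      simp only [List.forall_mem_cons, one_mul]
      exact ⟨h₄ _ (isKleinVector_one i2 i1) (by simp) (by simp) (by simp) (by simp [h11.symm]),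
        h₄ _ (isKleinVector_one i2 i2).swap₀₁.swap₁₂ (by simp) (by simp) (by simp)
          (by simp [h11.symm]),
        h₄ _ (isKleinVector_b i2).swap₁₂.swap₀₁.swap₁₂ (by simpa using hb0) (by simp) (by simp)
          (by simp [h11.symm]),
        h₄ _ (isKleinVector_neg_b i2).swap₁₂.swap₀₁.swap₁₂ (by simpa using hb0) (by simp) (by simp)
          (by simp [h11.symm]),
        h₄ _ (isKleinVector_b_sq i2 i1) (by simpa using hb0) (by simp) (by simp)
          (by simp [h11.symm]),
        h₄ _ (isKleinVector_neg_b_sq i2 i1) (by simpa using hb0) (by simp) (by simp)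
          (by simp [h11.symm]), by simp⟩)
    h4 (aeval_line_yz q2 hs hp)
  have hG' : ∀ w, IsKleinVector c b w → w 1 ≠ 0 → w 2 ≠ 0 → w 1 ≠ 1 * w 2 → w 1 ≠ -1 * w 2 →
      coneHom w (factorG c) = 0 := by
    intro w hw hw1 hw2 hw12 hw12'
    have h := hG w hw hw1 hw2
    rw [show (X 1 ^ 2 - X 2 ^ 2 : MvPolynomial (Fin 3) F) =
      (X 1 - C 1 * X 2) * (X 1 - C (-1) * X 2) by simp only [map_neg, map_one]; ring, map_mul,
      map_mul] at h
    exact (mul_eq_zero.1 h).resolve_left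
      (mul_ne_zero (coneHom_X_sub_ne_zero hw12) (coneHom_X_sub_ne_zero hw12'))
  have h₅ : ∀ w, IsKleinVector c b w → w 0 ≠ 0 → w 1 ≠ 0 → w 2 ≠ 0 → w 1 ≠ 1 * w 2 →
      w 1 ≠ -1 * w 2 → coneHom w a₅ = 0 :=
    fun w hw hw0 hw1 hw2 hw12 hw12' => coneHom_eq_zero_of_eq_add e₅ (h₄ w hw hw0 hw1 hw2 hw12)
      (hF w hw hw0 hw1) (coneHom_X_sub_ne_zero hw12')
  -- the lines `x = ± y` and `x = ± z`
  have hτ : ∀ τ, τ = b ∨ τ = -b ∨ τ = b ^ 2 ∨ τ = -b ^ 2 → τ ≠ 0 ∧ τ ≠ 1 ∧ τ ≠ -1 := by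
    rintro _ (rfl | rfl | rfl | rfl)
    · exact ⟨hb0, hb1, hb1'⟩
    · exact ⟨neg_ne_zero.2 hb0, fun h => hb1' (by rw [← h, neg_neg]), fun h => hb1 (neg_injective h)⟩
    · exact ⟨pow_ne_zero 2 hb0, hb2, hb2'⟩
    · exact ⟨neg_ne_zero.2 (pow_ne_zero 2 hb0), fun h => hb2' (by rw [← h, neg_neg]),
        fun h => hb2 (neg_injective h)⟩
  have hKτ : ∀ ε τ, ε = 1 ∨ ε = -1 → τ = b ∨ τ = -b ∨ τ = b ^ 2 ∨ τ = -b ^ 2 →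
      IsKleinVector c b ![ε, 1, τ] := by
    rintro ε τ hε (rfl | rfl | rfl | rfl)
    · exact (isKleinVector_b hε).swap₀₁
    · exact (isKleinVector_neg_b hε).swap₀₁
    · exact (isKleinVector_b_sq hε i1).swap₀₁.swap₁₂
    · exact (isKleinVector_neg_b_sq hε i1).swap₀₁.swap₁₂
  have hε0 : ∀ ε : F, ε = 1 ∨ ε = -1 → ε ≠ 0 := by rintro ε (rfl | rfl) <;> simp
  have hετ : ∀ ε τ, ε = 1 ∨ ε = -1 → τ = b ∨ τ = -b ∨ τ = b ^ 2 ∨ τ = -b ^ 2 →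
      ε ≠ 1 * τ ∧ ε ≠ -1 * τ := by
    rintro ε τ (rfl | rfl) h
    · exact ⟨by simpa using (hτ τ h).2.1.symm, fun h' => (hτ τ h).2.2 (by linear_combination h')⟩
    · exact ⟨by simpa using (hτ τ h).2.2.symm, fun h' => (hτ τ h).2.1 (by linear_combination h')⟩
  have hA : ∀ ε τ, ε = 1 ∨ ε = -1 → τ = b ∨ τ = -b ∨ τ = b ^ 2 ∨ τ = -b ^ 2 →
      coneHom ![ε, 1, τ] a₅ = 0 ∧ coneHom ![ε, 1, τ] (factorG c) = 0 := fun ε τ hε h =>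
    ⟨h₅ _ (hKτ ε τ hε h) (hε0 ε hε) one_ne_zero (hτ τ h).1 (hετ 1 τ i1 h).1 (hετ 1 τ i1 h).2,
      hG' _ (hKτ ε τ hε h) one_ne_zero (hτ τ h).1 (hετ 1 τ i1 h).1 (hετ 1 τ i1 h).2⟩
  have hB : ∀ ε τ, ε = 1 ∨ ε = -1 → τ = b ∨ τ = -b ∨ τ = b ^ 2 ∨ τ = -b ^ 2 →
      coneHom ![ε, τ, 1] a₅ = 0 ∧ coneHom ![ε, τ, 1] (factorG c) = 0 := fun ε τ hε h => by
    have n1 : τ ≠ 1 * 1 := by simpa using (hτ τ h).2.1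
    have n2 : τ ≠ -1 * 1 := by simpa using (hτ τ h).2.2
    exact ⟨h₅ _ (hKτ ε τ hε h).swap₁₂ (hε0 ε hε) (hτ τ h).1 one_ne_zero n1 n2,
      hG' _ (hKτ ε τ hε h).swap₁₂ (hτ τ h).1 one_ne_zero n1 n2⟩
  -- Only (1:1:τ) with τ = ±b, ±b² remain: (0:0:1), (1:1:0) and (1:1:±1) lie on lines already
  -- removed. The form is g divided by all its linear factors y, z, y ± z.
  obtain ⟨a₆, s₆, e₆⟩ := exists_eq_add_xy 1 (p := a₅) (m := factorG c) _
    (pairwise_line_xy h2 hs hp) (by simp)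
    (by
      simp only [List.forall_mem_cons, one_mul]
      exact ⟨(hA 1 _ i1 (by simp)).1, (hA 1 _ i1 (by simp)).1, (hA 1 _ i1 (by simp)).1,
        (hA 1 _ i1 (by simp)).1, by simp⟩)
    h4 (aeval_line_xy q1 hs hp)
  have hA₆ : ∀ τ, τ = b ∨ τ = -b ∨ τ = b ^ 2 ∨ τ = -b ^ 2 → coneHom ![-1, 1, τ] a₆ = 0 :=
    fun τ h => coneHom_eq_zero_of_eq_add e₆ (hA _ τ i2 h).1 (hA _ τ i2 h).2
      (coneHom_X_sub_ne_zero (by simpa using h11.symm))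
  obtain ⟨a₇, s₇, e₇⟩ := exists_eq_add_xy (-1) (p := a₆) (m := factorG c) _
    (pairwise_line_xy h2 hs hp) (by simp)
    (by
      simp only [List.forall_mem_cons, one_mul]
      exact ⟨hA₆ _ (by simp), hA₆ _ (by simp), hA₆ _ (by simp), hA₆ _ (by simp), by simp⟩)
    h4 (aeval_line_xy q2 hs hp)
  have hB₇ : ∀ ε τ, ε = 1 ∨ ε = -1 → τ = b ∨ τ = -b ∨ τ = b ^ 2 ∨ τ = -b ^ 2 →
      coneHom ![ε, τ, 1] a₇ = 0 := fun ε τ hε h =>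
    coneHom_eq_zero_of_eq_add e₇
      (coneHom_eq_zero_of_eq_add e₆ (hB ε τ hε h).1 (hB ε τ hε h).2
        (coneHom_X_sub_ne_zero (hετ ε τ hε h).1)) (hB ε τ hε h).2
      (coneHom_X_sub_ne_zero (hετ ε τ hε h).2)
  obtain ⟨a₈, s₈, e₈⟩ := exists_eq_add_xz 1 (p := a₇) (m := factorG c) _
    (pairwise_line_xz h2 hs hp) (by simp)
    (by
      simp only [List.forall_mem_cons, one_mul]
      exact ⟨hB₇ 1 _ i1 (by simp), hB₇ 1 _ i1 (by simp), hB₇ 1 _ i1 (by simp),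
        hB₇ 1 _ i1 (by simp), by simp⟩)
    h4 (aeval_line_xz q1 hs hp)
  have hB₈ : ∀ τ, τ = b ∨ τ = -b ∨ τ = b ^ 2 ∨ τ = -b ^ 2 → coneHom ![-1, τ, 1] a₈ = 0 :=
    fun τ h => coneHom_eq_zero_of_eq_add e₈ (hB₇ _ τ i2 h) (hB _ τ i2 h).2
      (coneHom_X_sub_ne_zero (by simpa using h11.symm))
  obtain ⟨a₉, s₉, e₉⟩ := exists_eq_add_xz (-1) (p := a₈) (m := factorG c) _
    (pairwise_line_xz h2 hs hp) (by simp)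
    (by
      simp only [List.forall_mem_cons, one_mul]
      exact ⟨hB₈ _ (by simp), hB₈ _ (by simp), hB₈ _ (by simp), hB₈ _ (by simp), by simp⟩)
    h4 (aeval_line_xz q2 hs hp)
  have hδ := delta_ne_zero' h2 h7 hc
  have hdd : (C (-(13 * c + 31))⁻¹ * C (-(13 * c + 31)) : MvPolynomial (Fin 3) F) = 1 := by
    rw [← C_mul, inv_mul_cancel₀ hδ, C_1]
  have hcomb := octics_combination c
  obtain ⟨fF, fG, fH⟩ := octics_factor c
  generalize C (-(13 * c + 31))⁻¹ = d at hdd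
  generalize C (-(13 * c + 31)) = δ at hdd hcomb
  generalize octicF c = f at *
  generalize octicG c = g at *
  generalize octicH c = h at *
  generalize factorF c = F' at *
  generalize factorG c = G' at *
  generalize factorH c = H' at *
  simp only [nineLines, map_one, map_neg] at hcomb e₄ e₅ e₆ e₇ e₈ e₉
  apply Ideal.mem_span_range_iff_exists_fun.2
  -- Back-substitution of the nine decompositions, each quotient octic being completed by the lines
  -- removed before it. The product of the nine removed equations is minus `nineLines` (x² - z²
  -- against z² - x²), hence the terms with -d·a₉.
  refine ⟨![s₁ + X 2 * (s₄ + (X 1 - X 2) * s₅) - d * a₉ * X 2,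
    s₃ + X 0 * (s₆ + (X 0 - X 1) * s₇ + (X 0 ^ 2 - X 1 ^ 2) * (s₈ + (X 0 - X 2) * s₉)) -
      d * a₉ * X 0, s₂ - d * a₉ * X 1], ?_⟩
  rw [Fin.sum_univ_three]
  simp only [Matrix.cons_val]
  linear_combination (exp := 1) -e₁ - X 2 * e₂ - X 2 * X 1 * e₃ - X 0 * X 1 * X 2 * e₄
    - X 0 * X 1 * X 2 * (X 1 - X 2) * e₅ - X 0 * X 1 * X 2 * (X 1 ^ 2 - X 2 ^ 2) *
      (e₆ + (X 0 - X 1) * e₇ + (X 0 ^ 2 - X 1 ^ 2) * (e₈ + (X 0 - X 2) * e₉))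
    + X 2 * (s₄ + (X 1 - X 2) * s₅) * fF
    + (s₃ + X 0 * (s₆ + (X 0 - X 1) * s₇ + (X 0 ^ 2 - X 1 ^ 2) * (s₈ + (X 0 - X 2) * s₉))) * fG
    + s₂ * fH - d * a₉ * hcomb - a₉ * (X 0 * X 1 * X 2 * (X 0 ^ 2 - X 1 ^ 2) *
      (X 1 ^ 2 - X 2 ^ 2) * (X 2 ^ 2 - X 0 ^ 2)) * hdd

theorem definingIdeal_eq_span_octics (h2 : (2 : F) ≠ 0) (h7 : (7 : F) ≠ 0) (hs : c + b = -1)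
    (hp : c * b = 2) : definingIdeal (kleinConfiguration c b) =
      Ideal.span (Set.range ![octicF c, octicG c, octicH c]) :=
  le_antisymm
    (fun _ hp' => mem_span_octics h2 h7 hs hp fun _ hw => coneHom_eq_zero_of_mem_definingIdeal hp' hw)
    (span_octics_le_definingIdeal hs hp)

end Ideal

/-! ### Counting normalized coordinate vectors -/

section Counting

open scoped Classical

/-- The multiple of a vector whose first non-zero entry is `1`. -/
noncomputable def normalize {F : Type*} [Field F] (w : Fin 3 → F) : Fin 3 → F :=
  if w 0 ≠ 0 then (w 0)⁻¹ • w else if w 1 ≠ 0 then (w 1)⁻¹ • w else (w 2)⁻¹ • w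

variable {F : Type*} [Field F] {c b : F}

theorem normalize_smul {r : F} (hr : r ≠ 0) (w : Fin 3 → F) : normalize (r • w) = normalize w := by
  simp only [normalize, Pi.smul_apply, smul_eq_mul, ne_eq, mul_eq_zero, hr, false_or, smul_smul]
  split_ifs <;> congr 1 <;> field_simp

theorem exists_normalize_eq_smul {w : Fin 3 → F} (hw : w ≠ 0) :
    ∃ r : F, r ≠ 0 ∧ normalize w = r • w := by
  by_cases h0 : w 0 = 0
  · by_cases h1 : w 1 = 0
    · by_cases h2 : w 2 = 0
      · exact absurd (by ext i; fin_cases i <;> simp [h0, h1, h2]) hw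
      · exact ⟨(w 2)⁻¹, inv_ne_zero h2, by simp [normalize, h0, h1]⟩
    · exact ⟨(w 1)⁻¹, inv_ne_zero h1, by simp [normalize, h0, h1]⟩
  · exact ⟨(w 0)⁻¹, inv_ne_zero h0, by simp [normalize, h0]⟩

theorem normalize_rep_injective :
    Function.Injective fun P : Projectivization F (Fin 3 → F) => normalize P.rep := by
  intro P Q h
  obtain ⟨r, hr, er⟩ := exists_normalize_eq_smul P.rep_nonzero
  obtain ⟨s, hs, es⟩ := exists_normalize_eq_smul Q.rep_nonzero
  rw [← P.mk_rep, ← Q.mk_rep, Projectivization.mk_eq_mk_iff']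
  refine ⟨r⁻¹ * s, ?_⟩
  have h' : r • P.rep = s • Q.rep := by rw [← er, ← es]; exact h
  rw [mul_smul, ← h', smul_smul, inv_mul_cancel₀ hr, one_smul]

/-- The values `t` for which `(1 : t : 0)` lies in the configuration. -/
noncomputable def edgeValues (c : F) : Finset F := {0, 1, -1, c, -c, c⁻¹, -c⁻¹}

/-- The pairs `(s, t)` for which `(1 : s : t)` lies in the configuration. -/
noncomputable def affineValues (c b : F) : Finset (F × F) :=
  {0} ×ˢ edgeValues c ∪ (edgeValues c).erase 0 ×ˢ {0} ∪ {1, -1} ×ˢ {1, -1, b, -b, b ^ 2, -b ^ 2} ∪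
    {b, -b, b ^ 2, -b ^ 2} ×ˢ {1, -1} ∪ {b⁻¹, -b⁻¹} ×ˢ {b⁻¹, -b⁻¹} ∪
    {(b ^ 2)⁻¹, -(b ^ 2)⁻¹} ×ˢ {(b ^ 2)⁻¹, -(b ^ 2)⁻¹}

/-- The normalized coordinate vectors of the configuration. -/
noncomputable def normalizedVectors (c b : F) : Finset (Fin 3 → F) :=
  (affineValues c b).image (fun x => ![1, x.1, x.2]) ∪
    (edgeValues c).image (fun t => ![0, 1, t]) ∪ {![0, 0, 1]}

theorem card_edgeValues (h2 : (2 : F) ≠ 0) (hs : c + b = -1) (hp : c * b = 2) :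
    (edgeValues c).card = 7 := by
  obtain ⟨h4, hc0, hb0, hc1, hc1', hb1, hb1', hc2, hc2', hb2, hb2'⟩ := coord_facts h2 hs hp
  clear hs hp
  rw [edgeValues]
  repeat rw [Finset.card_insert_of_notMem]
  · simp
  all_goals
    simp only [Finset.mem_insert, Finset.mem_singleton, not_or]
    and_intros <;> intro h <;> grind

theorem card_affineValues (h2 : (2 : F) ≠ 0) (hs : c + b = -1) (hp : c * b = 2) :
    (affineValues c b).card = 41 := by
  have hT := card_edgeValues h2 hs hp
  obtain ⟨h4, hc0, hb0, hc1, hc1', hb1, hb1', hc2, hc2', hb2, hb2'⟩ := coord_facts h2 hs hp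
  clear hs hp
  have hb4 : b ^ 2 ≠ 0 := pow_ne_zero 2 hb0
  have k1 : ∀ x : F, x ≠ 0 → ({x, -x} : Finset F).card = 2 := by
    intro x hx
    rw [Finset.card_insert_of_notMem, Finset.card_singleton]
    simp only [Finset.mem_singleton]
    intro h
    exact hx ((mul_eq_zero.1 (by linear_combination h : 2 * x = 0)).resolve_left h2)
  have k2 : ({b, -b, b ^ 2, -b ^ 2} : Finset F).card = 4 := by
    repeat rw [Finset.card_insert_of_notMem]
    · simp
    all_goals
      simp only [Finset.mem_insert, Finset.mem_singleton, not_or]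
      and_intros <;> intro h <;> grind
  have k3 : ({1, -1, b, -b, b ^ 2, -b ^ 2} : Finset F).card = 6 := by
    rw [Finset.card_insert_of_notMem, Finset.card_insert_of_notMem, k2]
    all_goals
      simp only [Finset.mem_insert, Finset.mem_singleton, not_or]
      and_intros <;> intro h <;> grind
  have k4 : ((edgeValues c).erase 0).card = 6 := by
    rw [Finset.card_erase_of_mem (by simp [edgeValues]), hT]
  have m1 : ∀ x : F, x ∈ ({0} : Finset F) → x = 0 := fun x hx => Finset.mem_singleton.1 hx
  have m2 : ∀ x y : F, x ∈ ({y, -y} : Finset F) → x ^ 2 = y ^ 2 := by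
    intro x y hx
    rw [Finset.mem_insert, Finset.mem_singleton] at hx
    rcases hx with rfl | rfl <;> ring
  have m3 : ∀ x : F, x ∈ ({b, -b, b ^ 2, -b ^ 2} : Finset F) → x ≠ 0 ∧ x ^ 2 ≠ 1 := by
    intro x hx
    simp only [Finset.mem_insert, Finset.mem_singleton] at hx
    rcases hx with rfl | rfl | rfl | rfl <;> refine ⟨by simp [hb0], fun h => ?_⟩ <;> grind
  have m3' : ∀ x : F, x ∈ ({1, -1, b, -b, b ^ 2, -b ^ 2} : Finset F) → x ≠ 0 := by
    intro x hx
    simp only [Finset.mem_insert, Finset.mem_singleton] at hx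
    rcases hx with rfl | rfl | rfl | rfl | rfl | rfl <;> simp [hb0]
  have hbi : b * b⁻¹ = 1 := mul_inv_cancel₀ hb0
  have hbi2 : b ^ 2 * (b ^ 2)⁻¹ = 1 := mul_inv_cancel₀ hb4
  rw [affineValues]
  -- The blocks have 7, 6, 12, 8, 4 and 4 elements. They are separated by which coordinates vanish
  -- and by the squares of the coordinates.
  repeat rw [Finset.card_union_of_disjoint]
  · simp only [Finset.card_product, Finset.card_singleton, hT, k4, k3, k2, k1 1 one_ne_zero,
      k1 _ (inv_ne_zero hb0), k1 _ (inv_ne_zero hb4)]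
  all_goals
    rw [Finset.disjoint_left]
    rintro ⟨s, t⟩ h h'
    simp only [Finset.mem_union, Finset.mem_product] at h h'
  · have := m1 _ h.1; exact Finset.ne_of_mem_erase h'.1 this
  · rcases h with (h | h)
    · have := m1 _ h.1; have := m2 _ _ h'.1; grind
    · have := m1 _ h.2; have := m3' _ h'.2; grind
  · rcases h with ((h | h) | h)
    · have := m1 _ h.1; have := m3 _ h'.1; grind
    · have := m1 _ h.2; have := m2 _ _ h'.2; grind
    · have := m2 _ _ h.1; have := m3 _ h'.1; grind
  · rcases h with (((h | h) | h) | h)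
    · have := m1 _ h.1; have := m2 _ _ h'.1; grind
    · have := m1 _ h.2; have := m2 _ _ h'.2; grind
    · have := m2 _ _ h.1; have := m2 _ _ h'.1; grind
    · have := m2 _ _ h.2; have := m2 _ _ h'.2; grind
  · rcases h with ((((h | h) | h) | h) | h)
    · have := m1 _ h.1; have := m2 _ _ h'.1; grind
    · have := m1 _ h.2; have := m2 _ _ h'.2; grind
    · have := m2 _ _ h.1; have := m2 _ _ h'.1; grind
    · have := m2 _ _ h.2; have := m2 _ _ h'.2; grind
    · have := m2 _ _ h.1; have := m2 _ _ h'.1; grind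

theorem card_normalizedVectors (h2 : (2 : F) ≠ 0) (hs : c + b = -1) (hp : c * b = 2) :
    (normalizedVectors c b).card = 49 := by
  rw [normalizedVectors, Finset.card_union_of_disjoint, Finset.card_union_of_disjoint,
    Finset.card_image_of_injective, Finset.card_image_of_injective, card_affineValues h2 hs hp,
    card_edgeValues h2 hs hp, Finset.card_singleton]
  · intro x y h
    simpa using congrFun h 2
  · rintro ⟨x, x'⟩ ⟨y, y'⟩ h
    have h1 := congrFun h 1
    have h2 := congrFun h 2
    simp at h1 h2
    simp [h1, h2]
  · rw [Finset.disjoint_left]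
    simp only [Finset.mem_image]
    rintro _ ⟨x, -, rfl⟩ ⟨y, -, h⟩
    simpa using congrFun h 0
  · rw [Finset.disjoint_left]
    simp only [Finset.mem_union, Finset.mem_image, Finset.mem_singleton]
    rintro _ (⟨x, -, rfl⟩ | ⟨y, -, rfl⟩) h
    · simpa using congrFun h 0
    · simpa using congrFun h 1

theorem perm_fin_three (σ : Equiv.Perm (Fin 3)) :
    (σ 0 = 0 ∧ σ 1 = 1 ∧ σ 2 = 2) ∨ (σ 0 = 0 ∧ σ 1 = 2 ∧ σ 2 = 1) ∨
    (σ 0 = 1 ∧ σ 1 = 0 ∧ σ 2 = 2) ∨ (σ 0 = 1 ∧ σ 1 = 2 ∧ σ 2 = 0) ∨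
    (σ 0 = 2 ∧ σ 1 = 0 ∧ σ 2 = 1) ∨ (σ 0 = 2 ∧ σ 1 = 1 ∧ σ 2 = 0) := by
  revert σ
  decide

theorem cons_mem_normalizedVectors {s t : F} (h : (s, t) ∈ affineValues c b) :
    ![1, s, t] ∈ normalizedVectors c b :=
  Finset.mem_union_left _ (Finset.mem_union_left _ (Finset.mem_image.2 ⟨_, h, rfl⟩))

theorem zero_cons_mem_normalizedVectors {t : F} (h : t ∈ edgeValues c) :
    ![0, 1, t] ∈ normalizedVectors c b :=
  Finset.mem_union_left _ (Finset.mem_union_right _ (Finset.mem_image.2 ⟨_, h, rfl⟩))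

theorem zero_zero_mem_normalizedVectors : ![0, 0, 1] ∈ normalizedVectors c b :=
  Finset.mem_union_right _ (Finset.mem_singleton_self _)

theorem zero_mem_edgeValues : (0 : F) ∈ edgeValues c := by simp [edgeValues]

theorem inv_mul_mem_edgeValues {x s : F} (hx : x = 1 ∨ x = c) (hs : s = 1 ∨ s = -1) :
    x⁻¹ * s ∈ edgeValues c ∧ s⁻¹ * x ∈ edgeValues c := by
  rcases hx with rfl | rfl <;> rcases hs with rfl | rfl <;> simp [edgeValues]

theorem mem_affineValues {s t : F} : (s, t) ∈ affineValues c b ↔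
    ((((s = 0 ∧ t ∈ edgeValues c ∨ (s ≠ 0 ∧ s ∈ edgeValues c) ∧ t = 0) ∨
    (s = 1 ∨ s = -1) ∧ (t = 1 ∨ t = -1 ∨ t = b ∨ t = -b ∨ t = b ^ 2 ∨ t = -b ^ 2)) ∨
    (s = b ∨ s = -b ∨ s = b ^ 2 ∨ s = -b ^ 2) ∧ (t = 1 ∨ t = -1)) ∨
    (s = b⁻¹ ∨ s = -b⁻¹) ∧ (t = b⁻¹ ∨ t = -b⁻¹)) ∨
    (s = (b ^ 2)⁻¹ ∨ s = -(b ^ 2)⁻¹) ∧ (t = (b ^ 2)⁻¹ ∨ t = -(b ^ 2)⁻¹) := by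
  simp only [affineValues, Finset.mem_union, Finset.mem_product, Finset.mem_insert,
    Finset.mem_singleton, Finset.mem_erase]

theorem mem_edgeValues {t : F} : t ∈ edgeValues c ↔
    t = 0 ∨ t = 1 ∨ t = -1 ∨ t = c ∨ t = -c ∨ t = c⁻¹ ∨ t = -c⁻¹ := by
  simp only [edgeValues, Finset.mem_insert, Finset.mem_singleton]

theorem mem_normalizedVectors {w : Fin 3 → F} : w ∈ normalizedVectors c b ↔
    ((∃ s t, (s, t) ∈ affineValues c b ∧ ![1, s, t] = w) ∨ ∃ t ∈ edgeValues c, ![0, 1, t] = w) ∨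
      w = ![0, 0, 1] := by
  simp only [normalizedVectors, Finset.mem_union, Finset.mem_image, Finset.mem_singleton,
    Prod.exists]

attribute [irreducible] edgeValues affineValues normalizedVectors

theorem normalize_mem_of_ne_zero {x y z : F} (hx : x ≠ 0)
    (h : (x⁻¹ * y, x⁻¹ * z) ∈ affineValues c b) : normalize ![x, y, z] ∈ normalizedVectors c b := by
  convert! cons_mem_normalizedVectors h using 1
  simp [normalize, hx]

theorem normalize_mem_of_zero {y z : F} (hy : y ≠ 0) (h : y⁻¹ * z ∈ edgeValues c) :
    normalize ![0, y, z] ∈ normalizedVectors c b := by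
  convert! zero_cons_mem_normalizedVectors h using 1
  simp [normalize, hy]

theorem normalize_mem_of_zero_zero {z : F} (hz : z ≠ 0) :
    normalize ![0, 0, z] ∈ normalizedVectors c b := by
  convert! zero_zero_mem_normalizedVectors (c := c) (b := b) using 1
  simp [normalize, hz]

theorem mem_affineValues_of_edge_left {t : F} (h : t ∈ edgeValues c) :
    (0, t) ∈ affineValues c b := by
  simp only [mem_affineValues, h, true_and, true_or]

theorem mem_affineValues_of_edge_right {t : F} (h : t ∈ edgeValues c) :
    (t, 0) ∈ affineValues c b := by
  by_cases ht : t = 0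
  · rw [ht] at h ⊢
    exact mem_affineValues_of_edge_left h
  · simp only [mem_affineValues, ne_eq, ht, h, not_false_eq_true, true_and, or_true, true_or]

/-- The permutations of an edge vector. -/
theorem normalize_edge_mem {x y : F} (hx : x ≠ 0) (h : x⁻¹ * y ∈ edgeValues c)
    (h' : y ≠ 0 → y⁻¹ * x ∈ edgeValues c) (σ : Equiv.Perm (Fin 3)) :
    normalize (![x, y, 0] ∘ σ) ∈ normalizedVectors c b := by
  have hvs : ![x, y, 0] ∘ σ = ![![x, y, 0] (σ 0), ![x, y, 0] (σ 1), ![x, y, 0] (σ 2)] := by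
    ext i; fin_cases i <;> rfl
  have h0 : (0 : F) ∈ edgeValues c := zero_mem_edgeValues
  rw [hvs]
  by_cases hy : y = 0
  · subst hy
    rcases perm_fin_three σ with ⟨e0, e1, e2⟩ | ⟨e0, e1, e2⟩ | ⟨e0, e1, e2⟩ | ⟨e0, e1, e2⟩ |
      ⟨e0, e1, e2⟩ | ⟨e0, e1, e2⟩ <;> rw [e0, e1, e2] <;> simp only [Matrix.cons_val]
    · exact normalize_mem_of_ne_zero hx (by
        rw [mul_zero]; exact mem_affineValues_of_edge_left h0)
    · exact normalize_mem_of_ne_zero hx (by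
        rw [mul_zero]; exact mem_affineValues_of_edge_left h0)
    · exact normalize_mem_of_zero hx (by rwa [mul_zero])
    · exact normalize_mem_of_zero_zero hx
    · exact normalize_mem_of_zero hx (by rwa [mul_zero])
    · exact normalize_mem_of_zero_zero hx
  · rcases perm_fin_three σ with ⟨e0, e1, e2⟩ | ⟨e0, e1, e2⟩ | ⟨e0, e1, e2⟩ | ⟨e0, e1, e2⟩ |
      ⟨e0, e1, e2⟩ | ⟨e0, e1, e2⟩ <;> rw [e0, e1, e2] <;> simp only [Matrix.cons_val]
    · exact normalize_mem_of_ne_zero hx (by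
        rw [mul_zero]; exact mem_affineValues_of_edge_right h)
    · exact normalize_mem_of_ne_zero hx (by
        rw [mul_zero]; exact mem_affineValues_of_edge_left h)
    · exact normalize_mem_of_ne_zero hy (by
        rw [mul_zero]; exact mem_affineValues_of_edge_right (h' hy))
    · exact normalize_mem_of_ne_zero hy (by
        rw [mul_zero]; exact mem_affineValues_of_edge_left (h' hy))
    · exact normalize_mem_of_zero hx h
    · exact normalize_mem_of_zero hy (h' hy)

/-- The permutations of a vector with two entries `± 1`. -/
theorem normalize_interior_mem {x s t : F} (hx : x ≠ 0) (hs : s = 1 ∨ s = -1)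
    (ht : t = 1 ∨ t = -1)
    (h : ∀ ε τ : F, (ε = 1 ∨ ε = -1) → (τ = 1 ∨ τ = -1) → (ε * x, τ) ∈ affineValues c b ∧
      (τ, ε * x) ∈ affineValues c b ∧ (ε * x⁻¹, τ * x⁻¹) ∈ affineValues c b)
    (σ : Equiv.Perm (Fin 3)) :
    normalize (![x, s, t] ∘ σ) ∈ normalizedVectors c b := by
  have hvs : ![x, s, t] ∘ σ = ![![x, s, t] (σ 0), ![x, s, t] (σ 1), ![x, s, t] (σ 2)] := by
    ext i; fin_cases i <;> rfl
  rw [hvs]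
  have hs0 : s ≠ 0 := by rcases hs with rfl | rfl <;> simp
  have ht0 : t ≠ 0 := by rcases ht with rfl | rfl <;> simp
  have hs1 : s⁻¹ = s := by rcases hs with rfl | rfl <;> simp
  have ht1 : t⁻¹ = t := by rcases ht with rfl | rfl <;> simp
  have hst : s * t = 1 ∨ s * t = -1 := by
    rcases hs with rfl | rfl <;> rcases ht with rfl | rfl <;> simp
  rcases perm_fin_three σ with ⟨e0, e1, e2⟩ | ⟨e0, e1, e2⟩ | ⟨e0, e1, e2⟩ | ⟨e0, e1, e2⟩ |
    ⟨e0, e1, e2⟩ | ⟨e0, e1, e2⟩ <;> rw [e0, e1, e2] <;> simp only [Matrix.cons_val]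
  · refine normalize_mem_of_ne_zero hx ?_
    rw [mul_comm _ s, mul_comm _ t]
    exact (h s t hs ht).2.2
  · refine normalize_mem_of_ne_zero hx ?_
    rw [mul_comm _ s, mul_comm _ t]
    exact (h t s ht hs).2.2
  · refine normalize_mem_of_ne_zero hs0 ?_
    rw [hs1]
    exact (h s _ hs hst).1
  · refine normalize_mem_of_ne_zero hs0 ?_
    rw [hs1]
    exact (h s _ hs hst).2.1
  · refine normalize_mem_of_ne_zero ht0 ?_
    rw [ht1, mul_comm t s]
    exact (h t _ ht hst).1
  · refine normalize_mem_of_ne_zero ht0 ?_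
    rw [ht1, mul_comm t s]
    exact (h t _ ht hst).2.1

theorem interior_mem_affineValues {x : F} (hx : x = 1 ∨ x = b ∨ x = b ^ 2) {ε τ : F}
    (hε : ε = 1 ∨ ε = -1) (hτ : τ = 1 ∨ τ = -1) : (ε * x, τ) ∈ affineValues c b ∧
      (τ, ε * x) ∈ affineValues c b ∧ (ε * x⁻¹, τ * x⁻¹) ∈ affineValues c b := by
  simp only [mem_affineValues]
  rcases hx with rfl | rfl | rfl <;> rcases hε with rfl | rfl <;> rcases hτ with rfl | rfl <;>
    simp only [one_mul, neg_mul, inv_one, true_or, or_true, true_and]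

theorem normalize_mem (hc0 : c ≠ 0) (hb0 : b ≠ 0) {w : Fin 3 → F} (hw : IsKleinVector c b w) :
    normalize w ∈ normalizedVectors c b := by
  obtain ⟨v, hv, σ, r, hr, rfl⟩ := hw
  rw [normalize_smul hr]
  obtain ⟨s, t, hs, ht, h⟩ := hv
  have hs0 : s ≠ 0 := by rcases hs with rfl | rfl <;> simp
  rcases h with rfl | rfl | rfl | rfl | rfl | rfl
  · exact normalize_edge_mem one_ne_zero (by rw [mul_zero]; exact zero_mem_edgeValues)
      (fun h => absurd rfl h) σ
  · exact normalize_edge_mem one_ne_zero (inv_mul_mem_edgeValues (.inl rfl) hs).1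
      (fun _ => (inv_mul_mem_edgeValues (.inl rfl) hs).2) σ
  · have htt : t * t = 1 := by rcases ht with rfl | rfl <;> simp
    have ht0 : t ≠ 0 := by rcases ht with rfl | rfl <;> simp
    have hts : t * s = 1 ∨ t * s = -1 := by
      rcases hs with rfl | rfl <;> rcases ht with rfl | rfl <;> simp
    -- Multiplying by the sign t and exchanging the outer coordinates puts b first, with signs in
    -- the other two places.
    have hsw : ![1, s, t * b] = (t • ![b, t * s, t]) ∘ Equiv.swap 0 2 := by
      ext i
      fin_cases i <;> simp [Equiv.swap_apply_def, ← mul_assoc, htt]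
    rw [hsw]
    change normalize (t • (![b, t * s, t] ∘
      ⇑((Equiv.swap 0 2 : Equiv.Perm (Fin 3)) * σ))) ∈ _
    rw [normalize_smul ht0]
    exact normalize_interior_mem hb0 hts ht
      (fun _ _ hε hτ => interior_mem_affineValues (.inr (.inl rfl)) hε hτ) _
  · exact normalize_edge_mem hc0 (inv_mul_mem_edgeValues (.inr rfl) hs).1
      (fun _ => (inv_mul_mem_edgeValues (.inr rfl) hs).2) σ
  · exact normalize_interior_mem one_ne_zero hs ht
      (fun _ _ hε hτ => interior_mem_affineValues (.inl rfl) hε hτ) σ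
  · exact normalize_interior_mem (pow_ne_zero 2 hb0) hs ht
      (fun _ _ hε hτ => interior_mem_affineValues (.inr (.inr rfl)) hε hτ) σ

end Counting

/-! ### Every listed vector is a point of the configuration -/

section Enumeration

variable {F : Type*} [Field F] {c b : F}

theorem IsKleinVector.of_smul {w : Fin 3 → F} {r : F} (hr : r ≠ 0)
    (hw : IsKleinVector c b (r • w)) : IsKleinVector c b w := by
  simpa [smul_smul, inv_mul_cancel₀ hr] using hw.smul (inv_ne_zero hr)

theorem isKleinVector_of_mem_edgeValues (hc0 : c ≠ 0) {t : F} (ht : t ∈ edgeValues c) :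
    IsKleinVector c b ![1, t, 0] := by
  have hn : (-1 : F) ≠ 0 := neg_ne_zero.2 one_ne_zero
  rcases mem_edgeValues.1 ht with rfl | rfl | rfl | rfl | rfl | rfl | rfl
  · exact isKleinVector_single
  · exact isKleinVector_one_zero (.inl rfl)
  · exact isKleinVector_one_zero (.inr rfl)
  · exact (isKleinVector_c_zero (.inl rfl)).swap₀₁
  · exact .of_smul hn (by simpa using (isKleinVector_c_zero (c := c) (.inr rfl)).swap₀₁)
  · exact .of_smul hc0 (by simpa [hc0] using isKleinVector_c_zero (c := c) (.inl rfl))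
  · exact .of_smul hc0 (by simpa [hc0] using isKleinVector_c_zero (c := c) (.inr rfl))

theorem isKleinVector_sign_one {s t : F} (hs : s = 1 ∨ s = -1)
    (ht : t = 1 ∨ t = -1 ∨ t = b ∨ t = -b ∨ t = b ^ 2 ∨ t = -b ^ 2) :
    IsKleinVector c b ![1, s, t] := by
  rcases ht with rfl | rfl | rfl | rfl | rfl | rfl
  · exact isKleinVector_one hs (.inl rfl)
  · exact isKleinVector_one hs (.inr rfl)
  · exact isKleinVector_b hs
  · exact isKleinVector_neg_b hs
  · exact (isKleinVector_b_sq hs (.inl rfl)).swap₀₁.swap₁₂.swap₀₁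
  · exact (isKleinVector_neg_b_sq hs (.inl rfl)).swap₀₁.swap₁₂.swap₀₁

/-- Rescaling by x turns (1, ±x⁻¹, ±x⁻¹) into (x, ±1, ±1); used for x = b and x = b². -/
theorem isKleinVector_inv {x s t : F} (hx : x ≠ 0)
    (h : ∀ ε τ : F, (ε = 1 ∨ ε = -1) → (τ = 1 ∨ τ = -1) → IsKleinVector c b ![x, ε, τ])
    (hs : s = x⁻¹ ∨ s = -x⁻¹) (ht : t = x⁻¹ ∨ t = -x⁻¹) : IsKleinVector c b ![1, s, t] := by
  refine .of_smul hx ?_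
  have e : x • ![1, s, t] = ![x, x * s, x * t] := by simp
  rw [e]
  apply h
  · rcases hs with rfl | rfl <;> simp [hx]
  · rcases ht with rfl | rfl <;> simp [hx]

theorem isKleinVector_b_first {ε τ : F} (hε : ε = 1 ∨ ε = -1) (hτ : τ = 1 ∨ τ = -1) :
    IsKleinVector c b ![b, ε, τ] := by
  rcases hτ with rfl | rfl
  · exact (isKleinVector_b hε).swap₁₂.swap₀₁.swap₁₂
  · refine .of_smul (neg_ne_zero.2 one_ne_zero) ?_
    have h := (isKleinVector_neg_b (c := c) (b := b) (s := -ε)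
      (by rcases hε with rfl | rfl <;> simp)).swap₁₂.swap₀₁.swap₁₂
    simpa using h

theorem isKleinVector_of_mem_affineValues (hc0 : c ≠ 0) (hb0 : b ≠ 0) {s t : F}
    (h : (s, t) ∈ affineValues c b) : IsKleinVector c b ![1, s, t] := by
  rcases mem_affineValues.1 h with ((((⟨rfl, ht⟩ | ⟨⟨-, hs⟩, rfl⟩) | ⟨hs, ht⟩) | ⟨hs, ht⟩) |
    ⟨hs, ht⟩) | ⟨hs, ht⟩
  · exact (isKleinVector_of_mem_edgeValues hc0 ht).swap₁₂
  · exact isKleinVector_of_mem_edgeValues hc0 hs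
  · exact isKleinVector_sign_one hs ht
  · exact (isKleinVector_sign_one ht (.inr (.inr hs))).swap₁₂
  · exact isKleinVector_inv hb0 (fun _ _ => isKleinVector_b_first) hs ht
  · exact isKleinVector_inv (pow_ne_zero 2 hb0) (fun _ _ => isKleinVector_b_sq) hs ht

theorem isKleinVector_of_mem_normalizedVectors (hc0 : c ≠ 0) (hb0 : b ≠ 0) {w : Fin 3 → F}
    (hw : w ∈ normalizedVectors c b) : IsKleinVector c b w ∧ normalize w = w := by
  rcases mem_normalizedVectors.1 hw with (⟨s, t, h, rfl⟩ | ⟨t, h, rfl⟩) | rfl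
  · exact ⟨isKleinVector_of_mem_affineValues hc0 hb0 h, by simp [normalize]⟩
  · exact ⟨(isKleinVector_of_mem_edgeValues hc0 h).swap₁₂.swap₀₁, by simp [normalize]⟩
  · exact ⟨isKleinVector_single.swap₀₁.swap₁₂, by simp [normalize]⟩

theorem ncard_kleinConfiguration (h2 : (2 : F) ≠ 0) (hs : c + b = -1) (hp : c * b = 2) :
    (kleinConfiguration c b).ncard = 49 := by
  obtain ⟨-, hc0, hb0, -⟩ := coord_facts h2 hs hp
  have himage : (fun P : Projectivization F (Fin 3 → F) => normalize P.rep) ''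
      kleinConfiguration c b = normalizedVectors c b := by
    ext w
    constructor
    · rintro ⟨P, hP, rfl⟩
      exact normalize_mem hc0 hb0 (isKleinVector_rep hP)
    · intro hw
      obtain ⟨hk, hn⟩ := isKleinVector_of_mem_normalizedVectors hc0 hb0 hw
      refine ⟨_, hk.mk_mem hk.ne_zero, ?_⟩
      obtain ⟨a, ha⟩ := Projectivization.exists_smul_eq_mk_rep F w hk.ne_zero
      change normalize (Projectivization.mk F w hk.ne_zero).rep = w
      rw [← ha, Units.smul_def, normalize_smul a.ne_zero, hn]
  rw [← Set.ncard_image_of_injective _ normalize_rep_injective, himage, Set.ncard_coe_finset,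
    card_normalizedVectors h2 hs hp]

end Enumeration

end KleinConfig

theorem proposition4p2 {F : Type*} [Field F] (h2 : ringChar F ≠ 2) (h7 : ringChar F ≠ 7)
    (c cbar : F)
    (hc : (Polynomial.X ^ 2 + Polynomial.X + 2 : Polynomial F) =
      (Polynomial.X - Polynomial.C c) * (Polynomial.X - Polynomial.C cbar)) :
    (KleinConfig.kleinConfiguration c cbar).ncard = 49 ∧
    (KleinConfig.octicF c).IsHomogeneous 8 ∧
    (KleinConfig.octicG c).IsHomogeneous 8 ∧
    (KleinConfig.octicH c).IsHomogeneous 8 ∧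
    KleinConfig.IsMinimallyGeneratedBy
      (KleinConfig.definingIdeal (KleinConfig.kleinConfiguration c cbar))
      ![KleinConfig.octicF c, KleinConfig.octicG c, KleinConfig.octicH c] ∧
    RingTheory.Sequence.IsRegular (MvPolynomial (Fin 3) F)
      [KleinConfig.cubic1 c, KleinConfig.cubic2 c, KleinConfig.cubic3 c] ∧
    ∃ Q : Fin 3 → MvPolynomial (Fin 3) F,
      KleinConfig.IsMinimalGradedFreeResolution
        (KleinConfig.definingIdeal (KleinConfig.kleinConfiguration c cbar))
        ![8, 8, 8] ![11, 13]
        (Fintype.linearCombination (MvPolynomial (Fin 3) F)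
          ![![KleinConfig.cubic1 c, KleinConfig.cubic2 c, KleinConfig.cubic3 c], Q])
        (Fintype.linearCombination (MvPolynomial (Fin 3) F)
          ![KleinConfig.octicF c, KleinConfig.octicG c, KleinConfig.octicH c]) := by
  have h2' := KleinConfig.two_ne_zero_of_ringChar h2
  have h7' := KleinConfig.seven_ne_zero_of_ringChar h7
  have hs := KleinConfig.roots_add hc
  have hp := KleinConfig.roots_mul hc
  have hroot : c ^ 2 + c + 2 = 0 := by linear_combination c * hs - hp
  rw [KleinConfig.definingIdeal_eq_span_octics h2' h7' hs hp]
  exact ⟨KleinConfig.ncard_kleinConfiguration h2' hs hp, KleinConfig.isHomogeneous_octicF c,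
    KleinConfig.isHomogeneous_octicG c, KleinConfig.isHomogeneous_octicH c,
    KleinConfig.isMinimallyGeneratedBy_octics h2' h7' hroot,
    KleinConfig.isRegular_cubics h2' h7' hroot, KleinConfig.quinticSyzygy c,
    KleinConfig.isMinimalGradedFreeResolution_octics h2' h7' hroot⟩
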